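/- Let $\beta$ be a parameter, $x\oplus y=x+y+\beta xy$ and $\bar y=\ominus y=-y/(1+\beta y)$. For $n\ge 2$ let $W(D_n)$ be the Weyl group of type $D_n$ with simple reflections $s_{\hat 1},s_1,\dots,s_{n-1}$ (in the Dynkin diagram $1-2-\cdots-(n-1)$ is a path, and $\hat 1$ is joined exactly to $2$), with length function $\ell$. Let $\mathrm{Id}_\beta(W(D_n))$ be the algebra generated by the $u_i$ (one for each simple reflection) with relations $u_i^2=\beta u_i$ and $u_iu_ju_i\cdots=u_ju_iu_j\cdots$ ($m_{ij}$ factors on each side, $m_{ij}$ the order of $s_is_j$), with coefficients extended to a commutative ring containing $\beta$ and the commuting variables $a_i,b_i,x_i$ and in which every $1+\beta b_i$ is invertible. It has the basis $u_w=u_{i_1}\cdots u_{i_l}$, $w=s_{i_1}\cdots s_{i_l}\in W(D_n)$ a reduced expression. Put $h_i(y)=1+yu_i$, $A_i(y)=h_{n-1}(y)h_{n-2}(y)\cdots h_i(y)$, $G_A(y_1,\dots,y_{n-1})=A_1(y_1)\cdots A_{n-1}(y_{n-1})$ and $F(y)=h_{n-1}(y)\cdots h_2(y)\,h_{\hat 1}(y)h_1(y)\,h_2(y)\cdots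 h_{n-1}(y)$, and define $\mathcal G^D_{n,w}(a,b;x)$ by $$G_A(\bar b_1,\dots,\bar b_{n-1})^{-1}\,F(x_1)\cdots F(x_n)\,G_A(a_1,\dots,a_{n-1})=\sum_{w\in W(D_n)}\mathcal G^D_{n,w}(a,b;x)\,u_w .$$ For even $n=2m$ let $\Delta^D_n=(d_1,\dots,d_N)$, $N=\frac{n(n-1)}2+n(n-1)$, be the following sequence of simple reflections with coordinates, read row by row: first, for $r=1,\dots,n-1$, the row $s_{n-r},s_{n-r+1},\dots,s_{n-1}$ at the coordinates $(1,2n-r),\dots,(r,2n-r)$; then, for $t=0,\dots,n-1$, the row $s_*,s_2,s_3,\dots,s_{n-1}$ at the coordinates $(t+2,n-t),(t+3,n-t),\dots,(t+n,n-t)$, where $s_*=s_{\hat 1}$ if $t$ is even and $s_*=s_1$ if $t$ is odd. The weight of the entry at $(i,j)$ is $wt=p_i\oplus q_j$, where $p_i=x_{n+1-i}$ for $i\le n$, $p_i=a_{i-n}$ for $i>n$, $q_j=x_j$ for $j\le n$, $q_j=b_{j-n}$ for $j>n$. For $w\in W(D_n)$ let $\mathrm{Rsub}(\Delta^D_n,w)$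 be the set of subsequences $\mathbf D=(d_{j_1},\dots,d_{j_\ell})$, $j_1<\dots<j_\ell$ (as sets of positions), that are reduced expressions of $w$, so $\ell=\ell(w)$ and $d_{j_1}\cdots d_{j_\ell}=w$. Let $B(\mathbf D)$ be the set of positions $j$, not in $\mathbf D$, such that $v\star d_j=v$, where $v$ is the product of the $d_{j_p}$ with $j_p<j$, and $\star$ is the Demazure product ($w\star v=z$ if $u_wu_v=\beta^{\ell(w)+\ell(v)-\ell(z)}u_z$). Put $$Wt(\mathbf D)=\prod_{\Box\in\mathbf D}wt(\Box)\prod_{\bigcirc\in B(\mathbf D)}\bigl(1+\beta\,wt(\bigcirc)\bigr).$$ Then for even $n\geq 2$ and every $w\in W(D_n)$ $$\mathcal G^D_{n,w}(a,b;x)=\sum_{\mathbf D\in\mathrm{Rsub}(\Delta^D_n,w)}Wt(\mathbf D).$$ For odd $n=2m-1\ge 3$ and $w\in W(D_{n})\subset W(D_{2m})$, $\mathcal G^D_{n,w}(a,b;x)$ is equal to the sum $\sum_{\mathbf D\in\mathrm{Rsub}(\Delta^D_{2m},w)}Wt(\mathbf D)$ for $2m$, taken with $x_{2m}=0$. -/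

import Mathlib

noncomputable section

namespace GrothD

/-! ### The idCoxeter algebra of a Coxeter group -/

section IdCoxeter

variable {B : Type*} (M : CoxeterMatrix B)

/-- Length of an element of the Coxeter group. -/
def len (w : M.Group) : ℕ := M.toCoxeterSystem.length w

/-- The product `s_{i₁} ⋯ s_{i_l}` of simple reflections in the Coxeter group. -/
def word (l : List B) : M.Group := M.toCoxeterSystem.wordProd l

variable {R : Type*} [CommRing R] (β : R)

/-- The defining relations of the idCoxeter algebra: `u_i² = β u_i` and the braid relations
`u_i u_j u_i ⋯ = u_j u_i u_j ⋯` with `m_{ij}` factors on each side. -/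
inductive IdRel : FreeAlgebra R B → FreeAlgebra R B → Prop
  | sq (i : B) : IdRel (FreeAlgebra.ι R i * FreeAlgebra.ι R i) (β • FreeAlgebra.ι R i)
  | braid (i j : B) : IdRel
      (((CoxeterSystem.alternatingWord i j (M i j)).map (FreeAlgebra.ι R)).prod)
      (((CoxeterSystem.alternatingWord j i (M i j)).map (FreeAlgebra.ι R)).prod)

/-- The idCoxeter algebra `Id_β(W)`, with coefficients extended to `R`. -/
abbrev IdCox : Type _ := RingQuot (IdRel M β)

/-- The generator `u_i`. -/
def uGen (i : B) : IdCox M β := RingQuot.mkAlgHom R (IdRel M β) (FreeAlgebra.ι R i)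

/-- The element `u_w = u_{i₁} ⋯ u_{i_l}`, for a reduced expression `w = s_{i₁} ⋯ s_{i_l}`
(by the braid relations it does not depend on the reduced expression). -/
def uElt (w : M.Group) : IdCox M β :=
  (((M.toCoxeterSystem.exists_isReduced w).choose).map (uGen M β)).prod

/-- `h_i(y) = 1 + y u_i`. -/
def h (y : R) (i : B) : IdCox M β := 1 + y • uGen M β i

/-- The product `h_{i₁}(y) h_{i₂}(y) ⋯ h_{i_l}(y)`. -/
def hProd (y : R) (l : List B) : IdCox M β := (l.map (h M β y)).prod

/-- `x ⊕ y = x + y + β x y`. -/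
def oplus (y z : R) : R := y + z + β * y * z

/-- `⊖ y = - y / (1 + β y)`; it is used only where `1 + β y` is a unit. -/
def ominus (y : R) : R := -y * Ring.inverse (1 + β * y)

/-- `w ⋆ v = z` for the Demazure product: `u_w u_v = β^{ℓ(w) + ℓ(v) - ℓ(z)} u_z` in the
idCoxeter algebra over `ℤ[β]`. -/
def IsDemazure (w v z : M.Group) : Prop :=
  len M z ≤ len M w + len M v ∧
    uElt M (Polynomial.X : Polynomial ℤ) w * uElt M (Polynomial.X : Polynomial ℤ) v =
      (Polynomial.X : Polynomial ℤ) ^ (len M w + len M v - len M z) •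
        uElt M (Polynomial.X : Polynomial ℤ) z

/-! ### Reduced subwords of a sequence of simple reflections

An entry `(k, i, j)` of a sequence stands for the simple reflection `s_k` at the
coordinate `(i, j)`. -/

/-- The simple reflections of the sequence `Δ` at the positions in `D`, in order. -/
def subword (Δ : List (B × ℕ × ℕ)) (D : Finset (Fin Δ.length)) : List B :=
  ((List.finRange Δ.length).filter (fun k => k ∈ D)).map (fun k => (Δ.get k).1)

open Classical in
/-- `Rsub(Δ, w)`: the subsequences of `Δ` (as sets of positions) that are reduced
expressions of `w`. -/
def rsub (Δ : List (B × ℕ × ℕ)) (w : M.Group) : Finset (Finset (Fin Δ.length)) :=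
  Finset.univ.filter fun D => D.card = len M w ∧ word M (subword Δ D) = w

open Classical in
/-- The backward movable positions of `D`: the unselected positions `j` such that the product
`v` of the selected reflections to the left of `j` satisfies `v = v ⋆ d_j`. -/
def backward (Δ : List (B × ℕ × ℕ)) (D : Finset (Fin Δ.length)) : Finset (Fin Δ.length) :=
  Finset.univ.filter fun j => j ∉ D ∧
    IsDemazure M (word M (subword Δ (D.filter (fun k => k < j)))) (word M [(Δ.get j).1])
      (word M (subword Δ (D.filter (fun k => k < j))))

/-- `∏_{□ ∈ D} wt(□) · ∏_{○ ∈ B(D)} (1 + β wt(○))`, where `wt` is a function of the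
coordinate. -/
def Wt (wt : ℕ × ℕ → R) (Δ : List (B × ℕ × ℕ)) (D : Finset (Fin Δ.length)) : R :=
  (∏ k ∈ D, wt (Δ.get k).2) * ∏ k ∈ backward M Δ D, (1 + β * wt (Δ.get k).2)

end IdCoxeter

/-! ### Type `D_n`

The simple reflections are indexed by `Fin n`: the index `0` stands for `s_{1̂}`, and `k ≥ 1`
for `s_k`. In the Dynkin diagram `1 - 2 - ⋯ - (n-1)` is a path, and `1̂` is joined to `2`. -/

/-- `i` and `j` are joined, with `i < j`, in the Dynkin diagram of type `D`. -/
def DEdge (i j : ℕ) : Prop := (1 ≤ i ∧ j = i + 1) ∨ (i = 0 ∧ j = 2)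

instance (i j : ℕ) : Decidable (DEdge i j) := by unfold DEdge; infer_instance

/-- The Coxeter matrix of type `D_n`. -/
def coxD (n : ℕ) : CoxeterMatrix (Fin n) where
  M := Matrix.of fun i j : Fin n =>
    if i = j then 1 else if DEdge i j ∨ DEdge j i then 3 else 2
  isSymm := by
    ext i j
    simp only [Matrix.transpose_apply, Matrix.of_apply, eq_comm (a := j), or_comm]
  diagonal := by simp
  off_diagonal := by
    intro i j hij
    simp only [Matrix.of_apply, if_neg hij]
    split_ifs <;> norm_num

/-- The Weyl group `W(D_n)`. -/
abbrev WD (n : ℕ) : Type := (coxD n).Group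

/-- The natural embedding `W(D_n) → W(D_{n+1})`, `s_k ↦ s_k`. -/
def incl (n : ℕ) : WD n →* WD (n + 1) :=
  (coxD n).toCoxeterSystem.lift
    ⟨fun i => (coxD (n + 1)).toCoxeterSystem.simple i.castSucc, by
      intro i j
      have hM : coxD n i j = coxD (n + 1) i.castSucc j.castSucc := by
        change (if i = j then 1 else if DEdge i j ∨ DEdge j i then 3 else 2) =
          (if i.castSucc = j.castSucc then 1 else
            if DEdge i.castSucc j.castSucc ∨ DEdge j.castSucc i.castSucc then 3 else 2)
        simp
      rw [hM]
      exact (coxD (n + 1)).toCoxeterSystem.simple_mul_simple_pow _ _⟩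

section TypeD

variable {R : Type*} [CommRing R] (n : ℕ) (β : R)

/-- `A_i(y) = h_{n-1}(y) h_{n-2}(y) ⋯ h_i(y)` (for `i ≥ 1`). -/
def A (i : ℕ) (y : R) : IdCox (coxD n) β :=
  hProd (coxD n) β y ((List.finRange n).drop i).reverse

/-- `G_{A_{n-1}}(y₁, …, y_{n-1}) = A_1(y₁) A_2(y₂) ⋯ A_{n-1}(y_{n-1})`. -/
def GA (y : ℕ → R) : IdCox (coxD n) β :=
  ((List.range (n - 1)).map fun i => A n β (i + 1) (y (i + 1))).prod

/-- `F_n^D(y) = h_{n-1}(y) ⋯ h_2(y) · h_{1̂}(y) h_1(y) · h_2(y) ⋯ h_{n-1}(y)` (for `n ≥ 2`). -/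
def FD (y : R) : IdCox (coxD n) β :=
  hProd (coxD n) β y ((List.finRange n).drop 2).reverse *
    hProd (coxD n) β y ((List.finRange n).take 2) *
    hProd (coxD n) β y ((List.finRange n).drop 2)

/-- The generating function
`G_n^D(a, b; x) = G_{A_{n-1}}(⊖b₁, …, ⊖b_{n-1})⁻¹ F_n^D(x₁) ⋯ F_n^D(x_n) G_{A_{n-1}}(a₁, …, a_{n-1})`. -/
def genD (a b x : ℕ → R) : IdCox (coxD n) β :=
  Ring.inverse (GA n β fun i => ominus β (b i)) *
    ((List.range n).map fun i => FD n β (x (i + 1))).prod * GA n β a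

/-- `g` is the family `(G^D_{n,w}(a, b; x))_w` of the coefficients of the generating function:
`g`, and no other family, satisfies `G_n^D(a, b; x) = ∑_w g_w u_w`. -/
def IsGrothD (a b x : ℕ → R) (g : WD n →₀ R) : Prop :=
  ∀ g' : WD n →₀ R, (genD n β a b x = g'.sum fun w c => c • uElt (coxD n) β w) ↔ g' = g

/-- The sequence `Δ_n^D` (for even `n`) with its coordinates. First the rows
`s_{n-r}, …, s_{n-1}` at `(1, 2n-r), …, (r, 2n-r)`, for `r = 1, …, n-1`; then the rows
`s_*, s_2, …, s_{n-1}` at `(t+2, n-t), …, (t+n, n-t)`, for `t = 0, …, n-1`, where `s_*` is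
`s_{1̂}` if `t` is even and `s_1` if `t` is odd. -/
def deltaD : List (Fin n × ℕ × ℕ) :=
  ((List.range (n - 1)).flatMap fun r =>
    ((List.finRange n).drop (n - (r + 1))).mapIdx fun c k => (k, c + 1, 2 * n - (r + 1))) ++
  ((List.range n).flatMap fun t =>
    ((List.finRange n).filter fun k : Fin n => k.val = t % 2 ∨ 2 ≤ k.val).mapIdx
      fun c k => (k, t + 2 + c, n - t))

/-- `p_i = x_{n+1-i}` if `i ≤ n`, and `p_i = a_{i-n}` if `i > n`. -/
def p (a x : ℕ → R) (i : ℕ) : R := if i ≤ n then x (n + 1 - i) else a (i - n)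

/-- `q_j = x_j` if `j ≤ n`, and `q_j = b_{j-n}` if `j > n`. -/
def q (b x : ℕ → R) (j : ℕ) : R := if j ≤ n then x j else b (j - n)

/-- The weight `p_i ⊕ q_j` of the coordinate `(i, j)`. -/
def wtD (a b x : ℕ → R) (c : ℕ × ℕ) : R := oplus β (p n a x c.1) (q n b x c.2)

/-- `∑_{D ∈ Rsub(Δ_n^D, w)} Wt(D)`. -/
def eydSum (a b x : ℕ → R) (w : WD n) : R :=
  ∑ D ∈ rsub (coxD n) (deltaD n) w, Wt (coxD n) β (wtD n β a b x) (deltaD n) D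

end TypeD

end GrothD

end

/-! The generating function factors into terms `1 + wt • u_k`, and its coefficients are then read
off. Multiply such a product out from the left. A factor `1 + y u_i` meeting `u_v` only multiplies
by `1 + β y` if `i` is a right descent of `v`. Otherwise the letter may be skipped with weight `1`
or taken with weight `y`. So for any sequence the coefficient of `u_w` is the weighted sum over
reduced subwords (`prod_map_h_eq_sum`). For even `n` it remains to see that `genD` is the product
along `deltaD` (`genD_eq_prod`).

This rests on the Yang–Baxter relation `factor_braid`. The Dynkin diagram consists of two paths with
common part `2, …, n-1` and ends `1` and `1̂`. On a path, an increasing product times a staircase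
`G_A` is a shorter staircase times a row of factors (`fwd_mul_stair`). As `F(x)` descends to one end
and ascends from the other, `F(x)` times a staircase on one path is a staircase on the other path,
with `x` prepended to its parameters, times a row (`forkElt_mul_stair`). The `F(x_k)` commute
(`commute_forkElt`), so they can be applied in the order `x_1, …, x_n`. The ends of the rows
alternate, and for even `n` the staircase returns to the path of type `A`. There `G_A(⊖b)⁻¹` turns
it into a triangle of rows (`invStair_mul_stair_eq_triangle`). Triangle and rows together spell
`deltaD`.

For odd `n`, killing the last generator maps the algebra of `D_{n+1}` to that of `D_n`. It sends
`u_v` to `u_w` if `v` is the image of `w`, to `0` if `v` is outside `W(D_n)`, and the generating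
function with `x_{n+1} = 0` to the one for `n`.

Uniqueness of coefficients is the linear independence of the `u_w` (`sum_smul_uElt_injective`). It
follows from the exchange property and Matsumoto's theorem, through operators of left multiplication
on the free module over the group. -/

noncomputable section

/-! ### The exchange property -/

namespace CoxeterSystem

open List

variable {B W : Type*} [Group W] {M : CoxeterMatrix B} (cs : CoxeterSystem M W)

lemma prod_map_alternatingWord_two_mul {G : Type*} [Monoid G] (f : B → G) (i j : B) (m : ℕ) :
    ((alternatingWord i j (2 * m)).map f).prod = (f i * f j) ^ m := by
  induction m with
  | zero => simp [alternatingWord]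
  | succ m ih =>
    rw [show 2 * (m + 1) = 2 * m + 1 + 1 by ring, alternatingWord_succ, alternatingWord_succ,
      pow_succ, ← ih]
    simp

/-- As `(s_i s_j)^m = 1` for `m = M i j`, the sequence has period `m`. Hence every reflection occurs
an even number of times in it, which makes `signedConj` respect the Coxeter relations. -/
lemma leftInvSeq_alternatingWord_drop (i j : B) :
    (cs.leftInvSeq (alternatingWord i j (2 * M i j))).drop (M i j) =
      (cs.leftInvSeq (alternatingWord i j (2 * M i j))).take (M i j) := by
  apply List.ext_getElem
  · simp; omega
  · intro k h₁ h₂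
    simp only [length_drop, length_take, length_leftInvSeq, length_alternatingWord] at h₁ h₂
    rw [getElem_drop, getElem_take, getElem_leftInvSeq_alternatingWord _ _ _ _ _ (by omega),
      getElem_leftInvSeq_alternatingWord _ _ _ _ _ (by omega),
      prod_alternatingWord_eq_mul_pow, prod_alternatingWord_eq_mul_pow,
      show (2 * (M i j + k) + 1) / 2 = M i j + k by omega,
      show (2 * k + 1) / 2 = k by omega, pow_add, simple_mul_simple_pow']
    simp

open Classical in
/-- The action of a simple reflection on pairs of a group element and a sign. -/
def signedConj (i : B) : Function.End (W × ZMod 2) := fun p =>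
  (cs.simple i * p.1 * cs.simple i, p.2 + if p.1 = cs.simple i then 1 else 0)

open Classical in
lemma prod_map_signedConj (ω : List B) (p : W × ZMod 2) :
    (ω.map cs.signedConj).prod p =
      (cs.wordProd ω * p.1 * (cs.wordProd ω)⁻¹, p.2 + ((cs.rightInvSeq ω).count p.1 : ℕ)) := by
  induction ω with
  | nil => simp; rfl
  | cons i ω ih =>
    rw [map_cons, prod_cons]
    change cs.signedConj i ((ω.map cs.signedConj).prod p) = _
    rw [ih, signedConj]
    ext
    · simp [wordProd_cons, mul_assoc]
    · simp only [rightInvSeq, count_cons, Nat.cast_add, add_assoc, beq_iff_eq]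
      congr 2
      have : cs.wordProd ω * p.1 * (cs.wordProd ω)⁻¹ = cs.simple i ↔
          (cs.wordProd ω)⁻¹ * cs.simple i * cs.wordProd ω = p.1 := by
        constructor
        · intro h; rw [← h]; group
        · intro h; rw [← h]; group
      simp [this]

lemma signedConj_isLiftable : M.IsLiftable cs.signedConj := by
  classical
  intro i j
  rw [← prod_map_alternatingWord_two_mul]
  funext p
  rw [prod_map_signedConj]
  have hw : cs.wordProd (alternatingWord i j (2 * M i j)) = 1 := by
    rw [wordProd, prod_map_alternatingWord_two_mul, simple_mul_simple_pow]
  have hc : ((cs.rightInvSeq (alternatingWord i j (2 * M i j))).count p.1 : ZMod 2) = 0 := by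
    have hr : alternatingWord i j (2 * M i j) =
        (alternatingWord j i (2 * M i j)).reverse := by
      apply List.ext_getElem
      · simp
      · intro k h₁ h₂
        simp only [length_reverse, length_alternatingWord] at h₁ h₂
        rw [getElem_reverse, getElem_alternatingWord _ _ _ _ h₁,
          getElem_alternatingWord _ _ _ _ (by simp; omega)]
        simp only [length_alternatingWord]
        by_cases hk : Even k
        · rw [if_pos (by simp [Nat.even_add, hk]), if_neg]
          rw [Nat.not_even_iff_odd]
          obtain ⟨r, rfl⟩ := hk
          exact ⟨2 * M i j - 1 - r, by omega⟩
        · rw [if_neg (by simp [Nat.even_add, hk]), if_pos]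
          rw [Nat.not_even_iff_odd] at hk
          obtain ⟨r, rfl⟩ := hk
          exact ⟨2 * M i j - 1 - r, by omega⟩
    rw [hr, rightInvSeq_reverse, count_reverse, M.symmetric i j,
      ← take_append_drop (M j i) (cs.leftInvSeq _), count_append,
      leftInvSeq_alternatingWord_drop]
    push_cast
    exact CharTwo.add_self_eq_zero _
  rw [hw, hc]
  simp
  rfl

open Classical in
-- The sign component of the `signedConj` action records this parity, and the action factors through
-- `W`.
lemma count_rightInvSeq_eq {ω ω' : List B} (h : cs.wordProd ω = cs.wordProd ω') (t : W) :
    ((cs.rightInvSeq ω).count t : ZMod 2) = (cs.rightInvSeq ω').count t := by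
  have key : ∀ ω : List B, cs.lift ⟨_, cs.signedConj_isLiftable⟩ (cs.wordProd ω) =
      (ω.map cs.signedConj).prod := by
    intro ω
    rw [wordProd, map_list_prod, map_map]
    congr 1
    apply map_congr_left
    intro i _
    exact cs.lift_apply_simple cs.signedConj_isLiftable i
  have h₁ := congrFun ((key ω).symm.trans ((congrArg _ h).trans (key ω'))) (t, 0)
  rw [prod_map_signedConj, prod_map_signedConj] at h₁
  simpa using congrArg Prod.snd h₁

/-- A reduced word ending in `i` has `s_i` exactly once in its inversion sequence. By parity, `s_i`
occurs for every word with the same product, reduced or not. -/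
lemma mem_rightInvSeq_of_isRightDescent {ω : List B} {i : B}
    (h : cs.IsRightDescent (cs.wordProd ω) i) : cs.simple i ∈ cs.rightInvSeq ω := by
  classical
  obtain ⟨ω', hω', h'⟩ := cs.exists_isReduced (cs.wordProd ω * cs.simple i)
  have hp : cs.wordProd (ω'.concat i) = cs.wordProd ω := by
    rw [wordProd_concat, ← h', simple_mul_simple_cancel_right]
  have hred : cs.IsReduced (ω'.concat i) := by
    rw [IsReduced, hp, length_concat, ← hω'.eq, ← h']
    exact ((cs.isRightDescent_iff).1 h).symm
  have hmem : cs.simple i ∈ cs.rightInvSeq (ω'.concat i) := by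
    rw [rightInvSeq_concat]; simp
  have hc := cs.count_rightInvSeq_eq hp (cs.simple i)
  rw [count_eq_one_of_mem hred.nodup_rightInvSeq hmem] at hc
  by_contra hn
  rw [count_eq_zero_of_not_mem hn] at hc
  simp at hc

/-- The exchange property. -/
theorem exists_eraseIdx_of_isRightDescent {ω : List B} {i : B}
    (h : cs.IsRightDescent (cs.wordProd ω) i) :
    ∃ k < ω.length, cs.wordProd ω * cs.simple i = cs.wordProd (ω.eraseIdx k) := by
  obtain ⟨k, hk, hk'⟩ := getElem_of_mem (cs.mem_rightInvSeq_of_isRightDescent h)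
  refine ⟨k, by simpa using hk, ?_⟩
  rw [← cs.wordProd_mul_getD_rightInvSeq, ← hk', getD_eq_getElem _ _ hk]

theorem exists_eraseIdx_of_isLeftDescent {ω : List B} {i : B}
    (h : cs.IsLeftDescent (cs.wordProd ω) i) :
    ∃ k < ω.length, cs.simple i * cs.wordProd ω = cs.wordProd (ω.eraseIdx k) := by
  have h' : cs.IsRightDescent (cs.wordProd ω.reverse) i := by
    rwa [wordProd_reverse, isRightDescent_inv_iff]
  obtain ⟨k, hk, e⟩ := cs.exists_eraseIdx_of_isRightDescent h'
  rw [length_reverse] at hk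
  refine ⟨ω.length - 1 - k, by omega, ?_⟩
  have := congrArg Inv.inv e
  rw [wordProd_reverse, mul_inv_rev, inv_inv, inv_simple, ← wordProd_reverse] at this
  rw [this]
  congr 1
  rw [eraseIdx_eq_take_drop_succ, eraseIdx_eq_take_drop_succ, reverse_append, take_reverse,
    drop_reverse, reverse_reverse, reverse_reverse]
  congr 2 <;> omega

/-- If neither `s_i w` nor `w s_j` is shorter than `w`, but `s_i w s_j` is not longer, then
`s_i w = w s_j`. -/
theorem simple_mul_eq_mul_simple {w : W} {i j : B} (hi : ¬ cs.IsLeftDescent w i)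
    (hj : ¬ cs.IsRightDescent w j) (hij : cs.IsLeftDescent (w * cs.simple j) i) :
    cs.simple i * w = w * cs.simple j := by
  obtain ⟨ω, hω, rfl⟩ := cs.exists_isReduced w
  rw [← wordProd_concat, concat_eq_append] at hij
  obtain ⟨k, hk, e⟩ := cs.exists_eraseIdx_of_isLeftDescent hij
  rw [length_append, length_singleton] at hk
  -- A letter erased inside `ω` would make `s_i w` shorter than `w`, so the erased letter is the
  -- final `j`.
  rcases Nat.lt_or_ge k ω.length with hk' | hk'
  · exfalso
    rw [eraseIdx_append_of_lt_length hk', wordProd_append, wordProd_append, ← mul_assoc] at e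
    have e' := mul_right_cancel e
    apply hi
    rw [IsLeftDescent, e', hω.eq]
    refine lt_of_le_of_lt (cs.length_wordProd_le _) ?_
    rw [length_eraseIdx_of_lt hk']
    omega
  · have : k = ω.length := by omega
    subst this
    rw [eraseIdx_append_of_length_le le_rfl, wordProd_append] at e
    simp only [Nat.sub_self, eraseIdx_cons_zero, append_nil, wordProd_singleton] at e
    simpa using (congrArg (cs.simple i * ·) e).symm

end CoxeterSystem

/-! ### Simply laced systems and Matsumoto's theorem -/

/-- A Coxeter matrix is simply laced if its off-diagonal entries are `2` or `3`. -/
def CoxeterMatrix.SimplyLaced {B : Type*} (M : CoxeterMatrix B) : Prop :=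
  ∀ i j, i ≠ j → M i j = 2 ∨ M i j = 3

namespace CoxeterSystem

open List

variable {B W : Type*} [Group W] {M : CoxeterMatrix B} (cs : CoxeterSystem M W)

section SimplyLaced

variable (hM : M.SimplyLaced)

open Classical in
/-- The Cartan integers of a simply laced Coxeter matrix. -/
def cartanEntry (M : CoxeterMatrix B) (i j : B) : ℤ :=
  if i = j then 2 else if M i j = 3 then -1 else 0

/-- The action of a simple reflection on the coordinates with respect to the simple roots. -/
def rootReflection (M : CoxeterMatrix B) (i : B) : Function.End (B → ℤ) :=
  fun f k => f k - cartanEntry M i k * f i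

include hM in
lemma rootReflection_isLiftable : M.IsLiftable (rootReflection M) := by
  intro i j
  have hs : ∀ i j, cartanEntry M i j = cartanEntry M j i := fun i j => by
    by_cases h : i = j
    · rw [h]
    · rw [cartanEntry, cartanEntry, if_neg h, if_neg (Ne.symm h), M.symmetric i j]
  have hd : ∀ i, cartanEntry M i i = 2 := fun i => by simp [cartanEntry]
  by_cases hij : i = j
  · subst hij
    rw [M.diagonal, pow_one]
    funext f k
    change (f k - _ * f i) - _ * (f i - cartanEntry M i i * f i) = f k
    rw [hd]; ring
  · rcases hM i j hij with h | h
    · have h0 : cartanEntry M i j = 0 := by simp [cartanEntry, hij, h]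
      rw [h, pow_two]
      funext f k
      change rootReflection M i (rootReflection M j (rootReflection M i (rootReflection M j (f)))) k = f k
      simp only [rootReflection, hs j i, hd, h0]
      ring
    · have h0 : cartanEntry M i j = -1 := by simp [cartanEntry, hij, h]
      rw [h, pow_succ, pow_two]
      funext f k
      change rootReflection M i (rootReflection M j (rootReflection M i (rootReflection M j
        (rootReflection M i (rootReflection M j (f)))))) k = f k
      simp only [rootReflection, hs j i, hd, h0]
      ring

include hM in
/-- The simple reflections of a simply laced Coxeter system are distinct. -/
theorem simple_injective_of_simplyLaced : Function.Injective cs.simple := by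
  classical
  intro i j h
  by_contra hij
  have h₁ := congrArg (cs.lift ⟨_, rootReflection_isLiftable hM⟩) h
  rw [cs.lift_apply_simple (rootReflection_isLiftable hM),
    cs.lift_apply_simple (rootReflection_isLiftable hM)] at h₁
  -- On the indicator of `i`, the coordinate at `i` becomes `-1` under `s_i` and stays `1` under
  -- `s_j`.
  have h₂ := congrFun (congrFun h₁ (Pi.single i 1)) i
  simp [rootReflection, cartanEntry, Pi.single_eq_of_ne (Ne.symm hij)] at h₂

include hM in
lemma simple_mul_simple_ne {i j : B} (hij : i ≠ j) (h : M i j = 3) :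
    cs.simple i * cs.simple j ≠ cs.simple j * cs.simple i := by
  intro hc
  have h₁ : (cs.simple i * cs.simple j) * (cs.simple i * cs.simple j) = 1 := by
    nth_rw 2 [hc]
    simp [mul_assoc]
  have h₂ := cs.simple_mul_simple_pow i j
  rw [h, pow_succ, pow_two, h₁, one_mul] at h₂
  apply hij
  apply cs.simple_injective_of_simplyLaced hM
  rw [mul_eq_one_iff_eq_inv, inv_simple] at h₂
  exact h₂

lemma braid_of_eq_three {i j : B} (h : M i j = 3) :
    cs.simple i * (cs.simple j * cs.simple i) = cs.simple j * (cs.simple i * cs.simple j) := by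
  have := cs.wordProd_braidWord_eq i j
  rw [braidWord, braidWord, M.symmetric j i, h] at this
  simpa [alternatingWord, wordProd] using this.symm

lemma comm_of_eq_two {i j : B} (h : M i j = 2) :
    cs.simple i * cs.simple j = cs.simple j * cs.simple i := by
  have := cs.wordProd_braidWord_eq i j
  rw [braidWord, braidWord, M.symmetric j i, h] at this
  simpa [alternatingWord, wordProd] using this

lemma isReduced_of_length_eq {ω : List B} {w : W} (h : cs.wordProd ω = w)
    (hl : ω.length = cs.length w) : cs.IsReduced ω := by
  rw [IsReduced, h, hl]

lemma IsReduced.tail {cs : CoxeterSystem M W} {i : B} {ω : List B}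
    (h : cs.IsReduced (i :: ω)) : cs.IsReduced ω := by
  simpa using h.drop 1

include hM in
lemma isReduced_pair {i j : B} (hij : i ≠ j) : cs.IsReduced [i, j] := by
  rw [IsReduced, wordProd_cons, wordProd_singleton]
  rcases cs.length_simple_mul (cs.simple j) i with h | h
  · simpa using h
  · exfalso
    rw [length_simple, Nat.add_eq_right, length_eq_zero_iff, mul_eq_one_iff_eq_inv,
      inv_simple] at h
    exact hij (cs.simple_injective_of_simplyLaced hM h)

include hM in
lemma isReduced_triple {i j : B} (hij : i ≠ j) (h3 : M i j = 3) :
    cs.IsReduced [j, i, j] := by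
  have h2 := cs.isReduced_pair hM hij
  rw [IsReduced, wordProd_cons]
  rcases cs.length_simple_mul (cs.wordProd [i, j]) j with h | h
  · rw [h, h2.eq]; rfl
  · exfalso
    obtain ⟨k, hk, e⟩ := cs.exists_eraseIdx_of_isLeftDescent ((cs.isLeftDescent_iff).2 h)
    have hk2 : k < 2 := hk
    interval_cases k
    · simp only [eraseIdx_cons_zero, wordProd_cons, wordProd_nil, mul_one] at e
      rw [← cs.braid_of_eq_three h3] at e
      have e' : cs.simple j * cs.simple i * cs.simple j = cs.simple j := by
        rw [mul_assoc, ← cs.braid_of_eq_three h3, e]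
      rw [mul_eq_right, mul_eq_one_iff_eq_inv, inv_simple] at e'
      exact hij (cs.simple_injective_of_simplyLaced hM e'.symm)
    · simp only [eraseIdx_cons_succ, eraseIdx_cons_zero, wordProd_cons, wordProd_nil,
        mul_one] at e
      apply cs.simple_mul_simple_ne hM hij h3
      rw [← cs.simple_mul_simple_cancel_left (w := cs.simple i * cs.simple j) j, e]

include hM in
/-- Matsumoto's theorem for simply laced Coxeter systems. -/
theorem prod_map_eq_of_isReduced {G : Type*} [Monoid G] {f : B → G}
    (hf : ∀ i j, ((alternatingWord i j (M i j)).map f).prod =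
      ((alternatingWord j i (M i j)).map f).prod)
    {ω ω' : List B} (hω : cs.IsReduced ω) (hω' : cs.IsReduced ω')
    (h : cs.wordProd ω = cs.wordProd ω') : (ω.map f).prod = (ω'.map f).prod := by
  induction hn : ω.length using Nat.strong_induction_on generalizing ω ω' with
  | _ n ih =>
  have hl : ω.length = ω'.length := by rw [← hω.eq, ← hω'.eq, h]
  match ω, ω' with
  | [], [] => rfl
  | [], _ :: _ => simp at hl
  | _ :: _, [] => simp at hl
  | i :: ω₁, j :: ω₁' =>
    simp only [length_cons, Nat.add_right_cancel_iff] at hl hn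
    by_cases hij : i = j
    · subst hij
      rw [wordProd_cons, wordProd_cons, mul_right_inj] at h
      rw [map_cons, map_cons, prod_cons, prod_cons,
        ih ω₁.length (by omega) hω.tail hω'.tail h rfl]
    have hlw : cs.length (cs.wordProd (i :: ω₁)) = ω₁.length + 1 := hω.eq
    have hjw : cs.simple j * cs.wordProd (i :: ω₁) = cs.wordProd ω₁' := by
      rw [h, wordProd_cons, simple_mul_simple_cancel_left]
    have hiw : cs.simple i * cs.wordProd (i :: ω₁) = cs.wordProd ω₁ := by
      rw [wordProd_cons, simple_mul_simple_cancel_left]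
    have hdj : cs.IsLeftDescent (cs.wordProd (i :: ω₁)) j := by
      rw [IsLeftDescent, hjw, hω'.tail.eq, hlw]; omega
    -- Exchange gives a third reduced word `j i ω₂` of the same element. It is compared with `j ω₁'`
    -- after cancelling `j`, and with `i ω₁` after a braid move.
    obtain ⟨k, hk, e⟩ := cs.exists_eraseIdx_of_isLeftDescent hdj
    obtain _ | k := k
    · rw [eraseIdx_cons_zero, wordProd_cons, ← mul_assoc, mul_eq_right,
        mul_eq_one_iff_eq_inv, inv_simple] at e
      exact absurd (cs.simple_injective_of_simplyLaced hM e).symm hij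
    rw [eraseIdx_cons_succ] at e
    simp only [length_cons, Nat.add_lt_add_iff_right] at hk
    obtain ⟨ω₂, hω₂⟩ : ∃ ω₂, ω₁.eraseIdx k = ω₂ := ⟨_, rfl⟩
    have hl₂ : ω₂.length + 1 = ω₁.length := by
      rw [← hω₂, length_eraseIdx_of_lt hk]; omega
    rw [hω₂] at e
    have ew : cs.wordProd (i :: ω₁) = cs.wordProd (j :: i :: ω₂) := by
      rw [wordProd_cons _ j, ← e, simple_mul_simple_cancel_left]
    have r₂ : cs.IsReduced (j :: i :: ω₂) :=
      cs.isReduced_of_length_eq ew.symm (by rw [hlw, ← hl₂]; rfl)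
    have e₁ : (ω₁'.map f).prod = ((i :: ω₂).map f).prod :=
      ih ω₁'.length (by omega) hω'.tail r₂.tail (by rw [← hjw, e]) rfl
    rcases hM i j hij with hm | hm
    · have ew' : cs.wordProd (i :: ω₁) = cs.wordProd (i :: j :: ω₂) := by
        rw [ew, wordProd_cons, wordProd_cons, wordProd_cons, wordProd_cons, ← mul_assoc,
          ← mul_assoc, cs.comm_of_eq_two hm]
      have r₃ : cs.IsReduced (i :: j :: ω₂) :=
        cs.isReduced_of_length_eq ew'.symm (by rw [hlw, ← hl₂]; rfl)
      have e₂ : (ω₁.map f).prod = ((j :: ω₂).map f).prod :=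
        ih ω₁.length (by omega) hω.tail r₃.tail (by
          rw [← hiw, ew', wordProd_cons _ i, simple_mul_simple_cancel_left]) rfl
      have hb := hf i j
      rw [hm] at hb
      simp only [alternatingWord, concat_eq_append, nil_append, map_append, map_cons, map_nil,
        prod_append, prod_cons, prod_nil, mul_one] at hb
      simp only [map_cons, prod_cons] at e₁ e₂ ⊢
      rw [e₁, e₂, ← mul_assoc, hb, mul_assoc]
    · have hdi : cs.IsLeftDescent (cs.wordProd (j :: i :: ω₂)) i := by
        rw [← ew, IsLeftDescent, hiw, hω.tail.eq, hlw]; omega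
      -- A second exchange erases neither leading letter: erasing `j` contradicts the length,
      -- erasing `i` makes `s_i` and `s_j` commute. So the element has the reduced words `i j i ω₃`
      -- and `j i j ω₃`.
      obtain ⟨k, hk, e'⟩ := cs.exists_eraseIdx_of_isLeftDescent hdi
      obtain _ | _ | k := k
      · exfalso
        rw [eraseIdx_cons_zero, wordProd_cons _ i, mul_right_inj] at e'
        have := cs.length_wordProd_le ω₂
        rw [← e', r₂.eq] at this
        simp at this
      · exfalso
        rw [eraseIdx_cons_succ, eraseIdx_cons_zero, wordProd_cons, wordProd_cons,
          wordProd_cons] at e'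
        apply cs.simple_mul_simple_ne hM hij hm
        rw [← mul_assoc, ← mul_assoc, mul_left_inj] at e'
        rw [← cs.simple_mul_simple_cancel_left (w := cs.simple j * cs.simple i) i,
          ← mul_assoc _ (cs.simple j), e']
      · rw [eraseIdx_cons_succ, eraseIdx_cons_succ] at e'
        simp only [length_cons, Nat.add_lt_add_iff_right] at hk
        obtain ⟨ω₃, hω₃⟩ : ∃ ω₃, ω₂.eraseIdx k = ω₃ := ⟨_, rfl⟩
        have hl₃ : ω₃.length + 1 = ω₂.length := by
          rw [← hω₃, length_eraseIdx_of_lt hk]; omega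
        rw [hω₃] at e'
        have ew₃ : cs.wordProd (i :: ω₁) = cs.wordProd (i :: j :: i :: ω₃) := by
          rw [ew, wordProd_cons _ i, ← e', simple_mul_simple_cancel_left]
        have ew₃' : cs.wordProd (i :: ω₁) = cs.wordProd (j :: i :: j :: ω₃) := by
          rw [ew₃]
          simp only [wordProd_cons, ← mul_assoc]
          rw [mul_assoc (cs.simple i), cs.braid_of_eq_three hm, ← mul_assoc]
        have r₃ : cs.IsReduced (i :: j :: i :: ω₃) :=
          cs.isReduced_of_length_eq ew₃.symm (by rw [hlw, ← hl₂, ← hl₃]; rfl)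
        have r₃' : cs.IsReduced (j :: i :: j :: ω₃) :=
          cs.isReduced_of_length_eq ew₃'.symm (by rw [hlw, ← hl₂, ← hl₃]; rfl)
        have e₂ : (ω₁.map f).prod = ((j :: i :: ω₃).map f).prod :=
          ih ω₁.length (by omega) hω.tail r₃.tail (by
            rw [← hiw, ew₃, wordProd_cons _ i, simple_mul_simple_cancel_left]) rfl
        have e₃ : (ω₁'.map f).prod = ((i :: j :: ω₃).map f).prod :=
          ih ω₁'.length (by omega) hω'.tail r₃'.tail (by
            rw [← hjw, ew₃', wordProd_cons _ j, simple_mul_simple_cancel_left]) rfl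
        have hb := hf i j
        rw [hm] at hb
        simp only [alternatingWord, concat_eq_append, nil_append, map_append, map_cons,
          map_nil, prod_append, prod_cons, prod_nil, mul_one] at hb
        simp only [map_cons, prod_cons] at e₂ e₃ ⊢
        rw [e₂, e₃]
        simp only [← mul_assoc]
        rw [hb]

end SimplyLaced

end CoxeterSystem

/-! ### The basis of the idCoxeter algebra -/

namespace GrothD

open List CoxeterSystem

section IdCoxeter

variable {B : Type*} {M : CoxeterMatrix B} {R : Type*} [CommRing R] {β : R}

lemma uGen_mul_self (i : B) : uGen M β i * uGen M β i = β • uGen M β i := by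
  have := RingQuot.mkAlgHom_rel R (IdRel.sq (M := M) (β := β) i)
  simpa [uGen] using this

lemma prod_map_uGen_braid (i j : B) :
    ((alternatingWord i j (M i j)).map (uGen M β)).prod =
      ((alternatingWord j i (M i j)).map (uGen M β)).prod := by
  have := RingQuot.mkAlgHom_rel R (IdRel.braid (M := M) (β := β) i j)
  rw [map_list_prod, map_list_prod, map_map, map_map] at this
  exact this

/-- Algebra homomorphisms out of the idCoxeter algebra. -/
def IdCox.lift {𝒜 : Type*} [Ring 𝒜] [Algebra R 𝒜] (f : B → 𝒜)
    (hsq : ∀ i, f i * f i = β • f i)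
    (hbr : ∀ i j, ((alternatingWord i j (M i j)).map f).prod =
      ((alternatingWord j i (M i j)).map f).prod) : IdCox M β →ₐ[R] 𝒜 :=
  RingQuot.liftAlgHom R ⟨FreeAlgebra.lift R f, by
    intro x y h
    cases h with
    | sq i => simpa using hsq i
    | braid i j =>
      rw [map_list_prod, map_list_prod, map_map, map_map]
      have : (⇑(FreeAlgebra.lift R f) ∘ FreeAlgebra.ι R) = f := by
        funext i; simp
      rw [this]
      exact hbr i j⟩

lemma IdCox.lift_uGen {𝒜 : Type*} [Ring 𝒜] [Algebra R 𝒜] (f : B → 𝒜)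
    (hsq : ∀ i, f i * f i = β • f i)
    (hbr : ∀ i j, ((alternatingWord i j (M i j)).map f).prod =
      ((alternatingWord j i (M i j)).map f).prod) (i : B) :
    IdCox.lift f hsq hbr (uGen M β i) = f i := by
  rw [IdCox.lift, uGen, RingQuot.liftAlgHom_mkAlgHom_apply]
  simp

variable (hM : M.SimplyLaced)

include hM in
lemma prod_map_uGen_of_isReduced {ω : List B} (h : M.toCoxeterSystem.IsReduced ω) :
    (ω.map (uGen M β)).prod = uElt M β (word M ω) :=
  M.toCoxeterSystem.prod_map_eq_of_isReduced hM prod_map_uGen_braid h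
    (M.toCoxeterSystem.exists_isReduced _).choose_spec.1
    (M.toCoxeterSystem.exists_isReduced (word M ω)).choose_spec.2

lemma uElt_eq_prod (w : M.Group) : ∃ ω, M.toCoxeterSystem.IsReduced ω ∧ word M ω = w ∧
    uElt M β w = (ω.map (uGen M β)).prod :=
  ⟨_, (M.toCoxeterSystem.exists_isReduced w).choose_spec.1,
    (M.toCoxeterSystem.exists_isReduced w).choose_spec.2.symm, rfl⟩

include hM in
lemma uElt_one : uElt M β (1 : M.Group) = 1 := by
  have := prod_map_uGen_of_isReduced (β := β) hM (ω := [])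
    (by simp [CoxeterSystem.IsReduced])
  simpa [word] using this.symm

include hM in
lemma uElt_mul_uGen_of_not_isRightDescent {w : M.Group} {i : B}
    (h : ¬ M.toCoxeterSystem.IsRightDescent w i) :
    uElt M β w * uGen M β i = uElt M β (w * M.toCoxeterSystem.simple i) := by
  obtain ⟨ω, hω, rfl, e⟩ := uElt_eq_prod (β := β) w
  have hr : M.toCoxeterSystem.IsReduced (ω.concat i) := by
    rw [CoxeterSystem.IsReduced, wordProd_concat, length_concat, ← hω.eq]
    exact (M.toCoxeterSystem.not_isRightDescent_iff).1 h
  have := prod_map_uGen_of_isReduced (β := β) hM hr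
  rw [word, wordProd_concat] at this
  rw [word, ← this, ← word, e]
  simp

include hM in
lemma uElt_mul_uGen_of_isRightDescent {w : M.Group} {i : B}
    (h : M.toCoxeterSystem.IsRightDescent w i) :
    uElt M β w * uGen M β i = β • uElt M β w := by
  have h' : ¬ M.toCoxeterSystem.IsRightDescent (w * M.toCoxeterSystem.simple i) i :=
    (M.toCoxeterSystem.isRightDescent_iff_not_isRightDescent_mul).1 h
  have e := uElt_mul_uGen_of_not_isRightDescent (β := β) hM h'
  rw [simple_mul_simple_cancel_right] at e
  rw [← e, mul_assoc, uGen_mul_self, mul_smul_comm]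

variable (M β)

open Classical in
/-- The operator of left multiplication by `u_i` in the basis `u_w`. -/
def leftOp (i : B) : (M.Group →₀ R) →ₗ[R] (M.Group →₀ R) :=
  Finsupp.linearCombination R fun w =>
    if M.toCoxeterSystem.IsLeftDescent w i then Finsupp.single w β
    else Finsupp.single (M.toCoxeterSystem.simple i * w) 1

open Classical in
/-- The operator of right multiplication by `u_i` in the basis `u_w`. -/
def rightOp (i : B) : (M.Group →₀ R) →ₗ[R] (M.Group →₀ R) :=
  Finsupp.linearCombination R fun w =>
    if M.toCoxeterSystem.IsRightDescent w i then Finsupp.single w β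
    else Finsupp.single (w * M.toCoxeterSystem.simple i) 1

variable {M β}

lemma leftOp_of_isLeftDescent {w : M.Group} {i : B}
    (h : M.toCoxeterSystem.IsLeftDescent w i) (c : R) :
    leftOp M β i (Finsupp.single w c) = Finsupp.single w (c * β) := by
  simp [leftOp, h]

lemma leftOp_of_not_isLeftDescent {w : M.Group} {i : B}
    (h : ¬ M.toCoxeterSystem.IsLeftDescent w i) (c : R) :
    leftOp M β i (Finsupp.single w c) =
      Finsupp.single (M.toCoxeterSystem.simple i * w) c := by
  simp [leftOp, h]

lemma rightOp_of_isRightDescent {w : M.Group} {i : B}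
    (h : M.toCoxeterSystem.IsRightDescent w i) (c : R) :
    rightOp M β i (Finsupp.single w c) = Finsupp.single w (c * β) := by
  simp [rightOp, h]

lemma rightOp_of_not_isRightDescent {w : M.Group} {i : B}
    (h : ¬ M.toCoxeterSystem.IsRightDescent w i) (c : R) :
    rightOp M β i (Finsupp.single w c) =
      Finsupp.single (w * M.toCoxeterSystem.simple i) c := by
  simp [rightOp, h]

/-- The only delicate case is when `s_i w` and `w s_j` are longer than `w` but `s_i w s_j` is not
longer than these. Then `s_i w = w s_j` by exchange. -/
lemma leftOp_comm_rightOp (i j : B) : Commute (leftOp M β i) (rightOp M β j) := by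
  let cs := M.toCoxeterSystem
  apply Finsupp.lhom_ext
  intro w c
  rw [Module.End.mul_apply, Module.End.mul_apply]
  by_cases hi : cs.IsLeftDescent w i <;> by_cases hj : cs.IsRightDescent w j
  · rw [leftOp_of_isLeftDescent hi, rightOp_of_isRightDescent hj,
      leftOp_of_isLeftDescent hi, rightOp_of_isRightDescent hj]
  · have h : cs.IsLeftDescent (w * cs.simple j) i := by
      have h₁ := (cs.not_isRightDescent_iff).1 hj
      have h₂ := cs.length_mul_le (cs.simple i * w) (cs.simple j)
      have h₃ := (cs.isLeftDescent_iff).1 hi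
      rw [cs.length_simple, mul_assoc] at h₂
      unfold CoxeterSystem.IsLeftDescent
      omega
    rw [leftOp_of_isLeftDescent hi, rightOp_of_not_isRightDescent hj,
      leftOp_of_isLeftDescent h, rightOp_of_not_isRightDescent hj]
  · have h : cs.IsRightDescent (cs.simple i * w) j := by
      have h₁ := (cs.not_isLeftDescent_iff).1 hi
      have h₂ := cs.length_mul_le (cs.simple i) (w * cs.simple j)
      have h₃ := (cs.isRightDescent_iff).1 hj
      rw [cs.length_simple, ← mul_assoc] at h₂
      unfold CoxeterSystem.IsRightDescent
      omega
    rw [leftOp_of_not_isLeftDescent hi, rightOp_of_isRightDescent hj,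
      leftOp_of_not_isLeftDescent hi, rightOp_of_isRightDescent h]
  · have h₁ := (cs.not_isLeftDescent_iff).1 hi
    have h₂ := (cs.not_isRightDescent_iff).1 hj
    have hiff : cs.IsLeftDescent (w * cs.simple j) i ↔
        cs.IsRightDescent (cs.simple i * w) j := by
      unfold CoxeterSystem.IsLeftDescent CoxeterSystem.IsRightDescent
      rw [h₁, h₂, mul_assoc]
    rw [leftOp_of_not_isLeftDescent hi, rightOp_of_not_isRightDescent hj]
    by_cases h : cs.IsLeftDescent (w * cs.simple j) i
    · rw [leftOp_of_isLeftDescent h, rightOp_of_isRightDescent (hiff.1 h)]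
      congr 1
      exact (cs.simple_mul_eq_mul_simple hi hj h).symm
    · rw [leftOp_of_not_isLeftDescent h,
        rightOp_of_not_isRightDescent (fun h' => h (hiff.2 h')), mul_assoc]

lemma leftOp_mul_self (i : B) : leftOp M β i * leftOp M β i = β • leftOp M β i := by
  let cs := M.toCoxeterSystem
  apply Finsupp.lhom_ext
  intro w c
  rw [Module.End.mul_apply, LinearMap.smul_apply]
  by_cases hi : cs.IsLeftDescent w i
  · rw [leftOp_of_isLeftDescent hi, leftOp_of_isLeftDescent hi, Finsupp.smul_single,
      smul_eq_mul, mul_comm β]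
  · have h : cs.IsLeftDescent (cs.simple i * w) i := by
      by_contra h
      exact hi ((cs.isLeftDescent_iff_not_isLeftDescent_mul).2 h)
    rw [leftOp_of_not_isLeftDescent hi, leftOp_of_isLeftDescent h, Finsupp.smul_single,
      smul_eq_mul, mul_comm β]

/-- The basis vector at `1` generates the module under the right operators, by induction on length.
-/
lemma eq_of_comm_rightOp {X Y : Module.End R (M.Group →₀ R)}
    (hX : ∀ j, Commute X (rightOp M β j)) (hY : ∀ j, Commute Y (rightOp M β j))
    (h : X (Finsupp.single 1 1) = Y (Finsupp.single 1 1)) : X = Y := by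
  let cs := M.toCoxeterSystem
  suffices hs : ∀ (n : ℕ) (w : M.Group), cs.length w = n →
      X (Finsupp.single w 1) = Y (Finsupp.single w 1) by
    apply Finsupp.lhom_ext
    intro w c
    rw [← mul_one c, ← smul_eq_mul, ← Finsupp.smul_single, map_smul, map_smul,
      hs _ w rfl]
  intro n
  induction n with
  | zero =>
    intro w hw
    rw [cs.length_eq_zero_iff] at hw
    rw [hw, h]
  | succ n ih =>
    intro w hw
    have hw1 : w ≠ 1 := by
      rintro rfl
      simp at hw
    obtain ⟨j, hj⟩ := cs.exists_rightDescent_of_ne_one hw1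
    have hl := (cs.isRightDescent_iff).1 hj
    have e : Finsupp.single w 1 =
        rightOp M β j (Finsupp.single (w * cs.simple j) 1) := by
      rw [rightOp_of_not_isRightDescent
        ((cs.isRightDescent_iff_not_isRightDescent_mul).1 hj),
        cs.simple_mul_simple_cancel_right]
    have h₁ := LinearMap.congr_fun (hX j) (Finsupp.single (w * cs.simple j) 1)
    have h₂ := LinearMap.congr_fun (hY j) (Finsupp.single (w * cs.simple j) 1)
    rw [Module.End.mul_apply, Module.End.mul_apply] at h₁ h₂
    rw [e, h₁, h₂, ih _ (by omega)]

lemma prod_map_leftOp_apply {ω : List B} (h : M.toCoxeterSystem.IsReduced ω) :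
    (ω.map (leftOp M β)).prod (Finsupp.single 1 1) = Finsupp.single (word M ω) 1 := by
  induction ω with
  | nil => simp [word]
  | cons i ω ih =>
    rw [map_cons, prod_cons, Module.End.mul_apply, ih h.tail, leftOp_of_not_isLeftDescent]
    · rfl
    · rw [not_isLeftDescent_iff]
      have h₁ := h.eq
      rw [wordProd_cons, length_cons, ← h.tail.eq] at h₁
      exact h₁

include hM in
-- Both sides commute with the right operators, so they need only agree at `1`. There each reduced
-- alternating word gives the basis vector of its product.
lemma prod_map_leftOp_braid (i j : B) :
    ((alternatingWord i j (M i j)).map (leftOp M β)).prod =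
      ((alternatingWord j i (M i j)).map (leftOp M β)).prod := by
  have hc : ∀ ω : List B, ∀ k, Commute (ω.map (leftOp M β)).prod (rightOp M β k) := by
    intro ω k
    apply Commute.list_prod_left
    intro x hx
    obtain ⟨i, -, rfl⟩ := mem_map.1 hx
    exact leftOp_comm_rightOp i k
  by_cases hij : i = j
  · rw [hij]
  have hr : ∀ i j, i ≠ j →
      M.toCoxeterSystem.IsReduced (alternatingWord i j (M i j)) := by
    intro i j hij
    rcases hM i j hij with h | h
    · rw [h]
      exact M.toCoxeterSystem.isReduced_pair hM hij
    · rw [h]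
      exact M.toCoxeterSystem.isReduced_triple hM hij h
  have hr' := hr j i (Ne.symm hij)
  rw [M.symmetric j i] at hr'
  apply eq_of_comm_rightOp (hc _) (hc _)
  rw [prod_map_leftOp_apply (hr i j hij), prod_map_leftOp_apply hr']
  congr 1
  have := M.toCoxeterSystem.wordProd_braidWord_eq i j
  rw [braidWord, braidWord, M.symmetric j i] at this
  exact this

/-- The representation of the idCoxeter algebra by operators of left multiplication. -/
def leftRep : IdCox M β →ₐ[R] Module.End R (M.Group →₀ R) :=
  IdCox.lift (leftOp M β) leftOp_mul_self (prod_map_leftOp_braid hM)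

lemma leftRep_uElt (w : M.Group) :
    leftRep hM (uElt M β w) (Finsupp.single 1 1) = Finsupp.single w 1 := by
  obtain ⟨ω, hω, rfl, e⟩ := uElt_eq_prod (β := β) w
  rw [e, map_list_prod, map_map, ← prod_map_leftOp_apply hω]
  congr 3
  funext i
  exact IdCox.lift_uGen _ _ _ i

include hM in
/-- The elements `u_w` are linearly independent. -/
theorem sum_smul_uElt_injective {g g' : M.Group →₀ R}
    (h : (g.sum fun w c => c • uElt M β w) = g'.sum fun w c => c • uElt M β w) : g = g' := by
  have key : ∀ g : M.Group →₀ R,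
      leftRep hM (g.sum fun w c => c • uElt M β w) (Finsupp.single 1 1) = g := by
    intro g
    rw [map_finsuppSum, Finsupp.sum, LinearMap.sum_apply]
    conv_rhs => rw [← Finsupp.sum_single g]
    apply Finset.sum_congr rfl
    intro w _
    rw [map_smul, LinearMap.smul_apply, leftRep_uElt, Finsupp.smul_single, smul_eq_mul,
      mul_one]
  rw [← key g, ← key g', h]

include hM in
lemma uElt_injective [Nontrivial R] : Function.Injective (uElt M β) := by
  intro w w' h
  have := congrArg (fun z => leftRep hM z (Finsupp.single 1 1)) h
  simp only [leftRep_uElt] at this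
  exact Finsupp.single_left_injective one_ne_zero this

include hM in
lemma uElt_ne_zero [Nontrivial R] (w : M.Group) : uElt M β w ≠ 0 := by
  intro h
  have := leftRep_uElt (β := β) hM w
  rw [h, map_zero, LinearMap.zero_apply] at this
  exact one_ne_zero (Finsupp.single_eq_zero.1 this.symm)

include hM in
lemma isDemazure_simple_iff (v : M.Group) (i : B) :
    IsDemazure M v (word M [i]) v ↔ M.toCoxeterSystem.IsRightDescent v i := by
  have hu : uElt M (Polynomial.X : Polynomial ℤ) (word M [i]) = uGen M Polynomial.X i := by
    rw [← prod_map_uGen_of_isReduced hM (ω := [i]) (by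
      rw [CoxeterSystem.IsReduced, wordProd_singleton, length_simple]; rfl)]
    simp
  have hl : len M (word M [i]) = 1 := by
    rw [len, word, wordProd_singleton, length_simple]
  rw [IsDemazure, hu, hl, Nat.add_sub_cancel_left, pow_one]
  constructor
  · rintro ⟨-, h⟩
    by_contra hd
    rw [uElt_mul_uGen_of_not_isRightDescent hM hd] at h
    have := congrArg (fun z => leftRep hM z (Finsupp.single 1 1)) h
    simp only [map_smul, LinearMap.smul_apply, leftRep_uElt, Finsupp.smul_single,
      smul_eq_mul, mul_one] at this
    -- Equality of the basis vectors would force `1 = X` or `1 = 0` in `ℤ[X]`.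
    rcases (Finsupp.single_eq_single_iff _ _ _ _).1 this with h | h
    · simpa using congrArg Polynomial.natDegree h.2
    · exact one_ne_zero h.1
  · intro hd
    exact ⟨by omega, uElt_mul_uGen_of_isRightDescent hM hd⟩

include hM in
-- At `β = 0` a descent kills the product. Since `u_w ≠ 0`, this is an algebraic test for
-- reducedness, used below to compare lengths in `D_n` and `D_{n+1}`.
lemma prod_map_uGen_zero_of_not_isReduced {ω : List B}
    (h : ¬ M.toCoxeterSystem.IsReduced ω) : (ω.map (uGen M (0 : R))).prod = 0 := by
  induction ω using List.reverseRecOn with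
  | nil => exact absurd (by simp [CoxeterSystem.IsReduced]) h
  | append_singleton ω i ih =>
    rw [map_append, prod_append, map_singleton, prod_singleton]
    by_cases hω : M.toCoxeterSystem.IsReduced ω
    · rw [prod_map_uGen_of_isReduced hM hω, uElt_mul_uGen_of_isRightDescent hM, zero_smul]
      by_contra hd
      apply h
      rw [CoxeterSystem.IsReduced, wordProd_append, wordProd_singleton, length_append,
        length_singleton, ← hω.eq]
      exact (M.toCoxeterSystem.not_isRightDescent_iff).1 hd
    · rw [ih hω, zero_mul]

end IdCoxeter

end GrothD

/-! ### Expansion over reduced subwords -/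

namespace GrothD

open List CoxeterSystem

lemma sum_finset_fin_succ {A : Type*} [AddCommMonoid A] (n : ℕ) (f : Finset (Fin (n + 1)) → A) :
    ∑ D, f D = ∑ D : Finset (Fin n),
      (f (D.map (Fin.succEmb n)) + f (insert 0 (D.map (Fin.succEmb n)))) := by
  have hinj : Set.InjOn (fun D : Finset (Fin n) => D.map (Fin.succEmb n))
      (Finset.univ : Finset (Finset (Fin n))) :=
    fun _ _ _ _ h => Finset.map_injective _ h
  have himg : ((Finset.univ : Finset (Fin n)).map (Fin.succEmb n)).powerset =
      Finset.univ.image (fun D : Finset (Fin n) => D.map (Fin.succEmb n)) := by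
    ext D
    simp only [Finset.mem_powerset, Finset.mem_image, Finset.mem_univ, true_and,
      Finset.subset_map_iff, Finset.subset_univ]
    exact ⟨fun ⟨u, h⟩ => ⟨u, h.symm⟩, fun ⟨u, h⟩ => ⟨u, h.symm⟩⟩
  have huniv : (Finset.univ : Finset (Fin (n + 1))) =
      insert 0 (Finset.univ.map (Fin.succEmb n)) := by
    ext k
    refine Fin.cases ?_ (fun k => ?_) k <;> simp
  rw [← Finset.powerset_univ, huniv,
    Finset.sum_powerset_insert (by simp), himg, Finset.sum_image hinj,
    Finset.sum_image hinj, Finset.sum_add_distrib]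

section Subwords

variable {B : Type*}

lemma subword_cons_map (d : B × ℕ × ℕ) (Δ : List (B × ℕ × ℕ)) (D : Finset (Fin Δ.length)) :
    subword (d :: Δ) (D.map (Fin.succEmb Δ.length)) = subword Δ D := by
  have h : ∀ k : Fin Δ.length, (k.succ ∈ D.map (Fin.succEmb Δ.length)) ↔ k ∈ D := by
    intro k
    simp
  have h0 : (0 : Fin (Δ.length + 1)) ∉ D.map (Fin.succEmb Δ.length) := by simp
  unfold subword
  change ((finRange (Δ.length + 1)).filter _).map _ = _
  rw [finRange_succ, filter_cons_of_neg (by simp), filter_map, map_map]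
  congr 1
  apply filter_congr
  intro k _
  simp only [Function.comp_apply, h]

lemma subword_cons_insert (d : B × ℕ × ℕ) (Δ : List (B × ℕ × ℕ)) (D : Finset (Fin Δ.length)) :
    subword (d :: Δ) (insert (0 : Fin (Δ.length + 1)) (D.map (Fin.succEmb Δ.length))) =
      d.1 :: subword Δ D := by
  have h : ∀ k : Fin Δ.length,
      (k.succ ∈ insert (0 : Fin (Δ.length + 1)) (D.map (Fin.succEmb Δ.length))) ↔ k ∈ D := by
    intro k
    simp
  unfold subword
  change ((finRange (Δ.length + 1)).filter _).map _ = _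
  rw [finRange_succ, filter_cons_of_pos (by simp), filter_map, map_cons, map_map]
  congr 2
  apply filter_congr
  intro k _
  simp only [Function.comp_apply, h]

lemma map_filter_lt_succ {n : ℕ} (D : Finset (Fin n)) (k : Fin n) :
    (D.map (Fin.succEmb n)).filter (· < k.succ) = (D.filter (· < k)).map (Fin.succEmb n) := by
  rw [Finset.filter_map]
  congr 1
  apply Finset.filter_congr
  intro j _
  simp

lemma insert_filter_lt_succ {n : ℕ} (D : Finset (Fin n)) (k : Fin n) :
    (insert 0 (D.map (Fin.succEmb n))).filter (· < k.succ) =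
      insert 0 ((D.filter (· < k)).map (Fin.succEmb n)) := by
  rw [Finset.filter_insert, if_pos (Fin.succ_pos k), map_filter_lt_succ]

end Subwords

section Expansion

variable {B : Type*} (M : CoxeterMatrix B) {R : Type*} [CommRing R] (β : R)

lemma length_subword (Δ : List (B × ℕ × ℕ)) (D : Finset (Fin Δ.length)) :
    (subword Δ D).length = D.card := by
  rw [subword, length_map, ← List.toFinset_card_of_nodup ((nodup_finRange _).filter _)]
  congr 1
  ext k
  simp

open Classical in
/-- The weight of a set of positions, the descents being those of the product of `v` and the
selected reflections. -/
def relWt (wt : ℕ × ℕ → R) (v : M.Group) (Δ : List (B × ℕ × ℕ)) (D : Finset (Fin Δ.length)) : R :=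
  ∏ k, if k ∈ D then wt (Δ.get k).2 else
    if M.toCoxeterSystem.IsRightDescent (v * word M (subword Δ (D.filter (· < k)))) (Δ.get k).1
    then 1 + β * wt (Δ.get k).2 else 1

variable {M β} (wt : ℕ × ℕ → R)

open Classical in
lemma relWt_cons_map (v : M.Group) (d : B × ℕ × ℕ) (Δ : List (B × ℕ × ℕ))
    (D : Finset (Fin Δ.length)) :
    relWt M β wt v (d :: Δ) (D.map (Fin.succEmb Δ.length)) =
      (if M.toCoxeterSystem.IsRightDescent v d.1 then 1 + β * wt d.2 else 1) *
        relWt M β wt v Δ D := by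
  unfold relWt
  rw [show (Finset.univ : Finset (Fin (d :: Δ).length)) =
    (Finset.univ : Finset (Fin (Δ.length + 1))) from rfl]
  erw [Fin.prod_univ_succ]
  congr 1
  · have h0 : (D.map (Fin.succEmb Δ.length)).filter (· < 0) = ∅ := by
      apply Finset.filter_false_of_mem
      intro j _
      exact Fin.not_lt_zero j
    erw [if_neg (by simp), h0]
    simp [subword, word]
  · apply Finset.prod_congr rfl
    intro k _
    erw [map_filter_lt_succ, subword_cons_map]
    simp

open Classical in
lemma relWt_cons_insert (v : M.Group) (d : B × ℕ × ℕ) (Δ : List (B × ℕ × ℕ))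
    (D : Finset (Fin Δ.length)) :
    relWt M β wt v (d :: Δ) (insert (0 : Fin (Δ.length + 1)) (D.map (Fin.succEmb Δ.length))) =
      wt d.2 * relWt M β wt (v * M.toCoxeterSystem.simple d.1) Δ D := by
  unfold relWt
  rw [show (Finset.univ : Finset (Fin (d :: Δ).length)) =
    (Finset.univ : Finset (Fin (Δ.length + 1))) from rfl]
  erw [Fin.prod_univ_succ]
  congr 1
  · erw [if_pos (by simp)]
    simp
  · apply Finset.prod_congr rfl
    intro k _
    erw [insert_filter_lt_succ, subword_cons_insert]
    rw [word, wordProd_cons, ← mul_assoc]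
    simp [word]
    rfl

variable (hM : M.SimplyLaced)

include hM in
open Classical in
-- The general prefix `v` makes the induction on `Δ` work: taking the first letter replaces `v` by
-- `v s_i`. The length condition says that the selected letters extend `v` without loss of length.
theorem uElt_mul_prod_map_h (v : M.Group) (Δ : List (B × ℕ × ℕ)) :
    uElt M β v * (Δ.map fun d => h M β (wt d.2) d.1).prod =
      ∑ D : Finset (Fin Δ.length),
        if len M (v * word M (subword Δ D)) = len M v + D.card then
          relWt M β wt v Δ D • uElt M β (v * word M (subword Δ D)) else 0 := by
  induction Δ generalizing v with
  | nil =>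
    have : (Finset.univ : Finset (Finset (Fin ([] : List (B × ℕ × ℕ)).length))) = {∅} := rfl
    rw [this, Finset.sum_singleton]
    simp [subword, word, relWt]
  | cons d Δ ih =>
    have hs := sum_finset_fin_succ Δ.length (fun D : Finset (Fin (d :: Δ).length) =>
      if len M (v * word M (subword (d :: Δ) D)) = len M v + D.card then
          relWt M β wt v (d :: Δ) D • uElt M β (v * word M (subword (d :: Δ) D)) else 0)
    have hw : ∀ l, v * word M (d.1 :: l) = v * M.toCoxeterSystem.simple d.1 * word M l := by
      intro l
      rw [word, wordProd_cons, ← mul_assoc, word]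
    have hcard : ∀ D : Finset (Fin Δ.length),
        (insert (0 : Fin (Δ.length + 1)) (D.map (Fin.succEmb Δ.length))).card = D.card + 1 := by
      intro D
      rw [Finset.card_insert_of_notMem (by simp), Finset.card_map]
    have hs' := hs.trans (Finset.sum_congr rfl fun D _ => by
      erw [subword_cons_map, subword_cons_insert, Finset.card_map, relWt_cons_map,
        relWt_cons_insert, hcard, hw])
    refine Eq.trans ?_ hs'.symm
    rw [map_cons, prod_cons, ← mul_assoc, h, mul_add, mul_one, mul_smul_comm,
      Finset.sum_add_distrib]
    by_cases hd : M.toCoxeterSystem.IsRightDescent v d.1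
    · rw [uElt_mul_uGen_of_isRightDescent hM hd]
      -- At a descent of `v`, no admissible subword contains the first position: the length drops at
      -- once and cannot be recovered.
      have hz : ∀ D : Finset (Fin Δ.length),
          ¬ len M (v * M.toCoxeterSystem.simple d.1 * word M (subword Δ D)) =
            len M v + (D.card + 1) := by
        intro D hD
        have h₁ := M.toCoxeterSystem.length_mul_le (v * M.toCoxeterSystem.simple d.1)
          (word M (subword Δ D))
        have h₂ := M.toCoxeterSystem.length_wordProd_le (subword Δ D)
        rw [length_subword] at h₂
        have h₃ := (M.toCoxeterSystem.isRightDescent_iff).1 hd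
        unfold len at hD
        unfold word at h₁ hD
        omega
      simp only [hz, if_false, Finset.sum_const_zero, add_zero, if_pos hd]
      have e : uElt M β v + wt d.2 • β • uElt M β v = (1 + β * wt d.2) • uElt M β v := by
        rw [add_smul, one_smul, smul_smul, mul_comm]
      rw [e, smul_mul_assoc, ih, Finset.smul_sum]
      apply Finset.sum_congr rfl
      intro D _
      rw [smul_ite, smul_smul, smul_zero]
    · rw [uElt_mul_uGen_of_not_isRightDescent hM hd, add_mul, smul_mul_assoc, ih, ih,
        Finset.smul_sum]
      congr 1
      · apply Finset.sum_congr rfl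
        intro D _
        rw [if_neg hd, one_mul]
      · apply Finset.sum_congr rfl
        intro D _
        have hl : len M (v * M.toCoxeterSystem.simple d.1) = len M v + 1 :=
          (M.toCoxeterSystem.not_isRightDescent_iff).1 hd
        rw [smul_ite, smul_smul, smul_zero, hl]
        congr 2
        rw [add_assoc, add_comm 1]

include hM in
lemma relWt_one (Δ : List (B × ℕ × ℕ)) (D : Finset (Fin Δ.length)) :
    relWt M β wt 1 Δ D = Wt M β wt Δ D := by
  classical
  have hsplit : ∀ k, (if k ∈ D then wt (Δ.get k).2 else
      if M.toCoxeterSystem.IsRightDescent (1 * word M (subword Δ (D.filter (· < k)))) (Δ.get k).1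
      then 1 + β * wt (Δ.get k).2 else 1) =
      (if k ∈ D then wt (Δ.get k).2 else 1) *
        (if k ∈ backward M Δ D then 1 + β * wt (Δ.get k).2 else 1) := by
    intro k
    have hk : k ∈ backward M Δ D ↔ k ∉ D ∧ M.toCoxeterSystem.IsRightDescent
        (word M (subword Δ (D.filter (· < k)))) (Δ.get k).1 := by
      rw [backward, Finset.mem_filter, isDemazure_simple_iff hM]
      simp only [Finset.mem_univ, true_and]
    rw [one_mul]
    simp only [hk]
    by_cases h : k ∈ D <;> simp [h]
  rw [Wt, relWt, Finset.prod_congr rfl fun k _ => hsplit k, Finset.prod_mul_distrib,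
    Finset.prod_ite_mem, Finset.prod_ite_mem, Finset.univ_inter, Finset.univ_inter]

variable (M β)

open Classical in
/-- The weighted sum over the reduced subwords, as a function of their product. -/
def subwordSum (Δ : List (B × ℕ × ℕ)) : M.Group →₀ R :=
  ∑ D : Finset (Fin Δ.length), if D.card = len M (word M (subword Δ D)) then
    Finsupp.single (word M (subword Δ D)) (Wt M β wt Δ D) else 0

lemma subwordSum_apply (Δ : List (B × ℕ × ℕ)) (w : M.Group) :
    subwordSum M β wt Δ w = ∑ D ∈ rsub M Δ w, Wt M β wt Δ D := by
  classical
  rw [subwordSum, rsub, Finset.sum_filter, Finsupp.finsetSum_apply]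
  apply Finset.sum_congr rfl
  intro D _
  by_cases hw : word M (subword Δ D) = w
  · subst hw
    by_cases hc : D.card = len M (word M (subword Δ D)) <;> simp [hc]
  · have hr : ¬ (D.card = len M w ∧ word M (subword Δ D) = w) := fun h' => hw h'.2
    rw [if_neg hr]
    split_ifs
    · exact Finsupp.single_eq_of_ne (Ne.symm hw)
    · rfl

include hM in
/-- The expansion of a product of factors `h_i` in the basis `u_w`. -/
theorem prod_map_h_eq_sum (Δ : List (B × ℕ × ℕ)) :
    (Δ.map fun d => h M β (wt d.2) d.1).prod =
      (subwordSum M β wt Δ).sum fun w c => c • uElt M β w := by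
  classical
  have := uElt_mul_prod_map_h (β := β) wt hM 1 Δ
  rw [uElt_one hM, one_mul] at this
  rw [this]
  have hlin : ∀ g : M.Group →₀ R, (g.sum fun w c => c • uElt M β w) =
      Finsupp.linearCombination R (uElt M β) g := fun g => rfl
  rw [hlin, subwordSum, map_sum]
  apply Finset.sum_congr rfl
  intro D _
  have hl : len M (1 : M.Group) = 0 := M.toCoxeterSystem.length_one
  rw [hl, zero_add, one_mul, relWt_one wt hM]
  by_cases hc : D.card = len M (word M (subword Δ D))
  · rw [if_pos hc, if_pos hc.symm, Finsupp.linearCombination_single]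
  · rw [if_neg hc, if_neg (Ne.symm hc), map_zero]

end Expansion

end GrothD

/-! ### Yang–Baxter identities on paths and forks -/

namespace GrothD

open List

section Algebra

variable {R 𝒜 ι : Type*} [CommRing R] [Ring 𝒜] [Algebra R 𝒜] (β : R) (u : ι → 𝒜)

/-- The factor `1 + y u_i`. -/
def factor (y : R) (i : ι) : 𝒜 := 1 + y • u i

/-- The product of the factors `1 + y u_i` along a list. -/
def fwd (L : List ι) (y : R) : 𝒜 := (L.map (factor u y)).prod

/-- The product of the factors `1 + y u_i` along a reversed list. -/
def bwd (L : List ι) (y : R) : 𝒜 := (L.reverse.map (factor u y)).prod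

/-- The product of `bwd` over the tails of a list. -/
def stair : List ι → (ℕ → R) → 𝒜
  | [], _ => 1
  | i :: L, y => bwd u (i :: L) (y 0) * stair L fun k => y (k + 1)

/-- A product of factors along a list with varying parameters. -/
def row : List ι → (ℕ → R) → 𝒜
  | [], _ => 1
  | i :: L, y => factor u (y 0) i * row L fun k => y (k + 1)

/-- The elements `u_i` along the list satisfy the braid relations of a path. -/
def IsPath : List ι → Prop
  | [] => True
  | [_] => True
  | i :: j :: L => u i * u j * u i = u j * u i * u j ∧ (∀ k ∈ L, Commute (u i) (u k)) ∧
      IsPath (j :: L)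

variable {u}

lemma IsPath.tail {i : ι} {L : List ι} (h : IsPath u (i :: L)) : IsPath u L := by
  cases L with
  | nil => trivial
  | cons j L => exact h.2.2

@[simp] lemma fwd_nil (y : R) : fwd u [] y = 1 := rfl
@[simp] lemma bwd_nil (y : R) : bwd u [] y = 1 := rfl

lemma fwd_cons (i : ι) (L : List ι) (y : R) : fwd u (i :: L) y = factor u y i * fwd u L y := by
  simp [fwd]

lemma bwd_cons (i : ι) (L : List ι) (y : R) : bwd u (i :: L) y = bwd u L y * factor u y i := by
  simp [bwd]

lemma stair_eq (L : List ι) (y : ℕ → R) :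
    stair u L y = bwd u L (y 0) * stair u L.tail fun k => y (k + 1) := by
  cases L <;> simp [stair]

lemma commute_factor {a : 𝒜} {i : ι} (h : Commute a (u i)) (y : R) :
    Commute a (factor u y i) :=
  (Commute.one_right a).add_right (h.smul_right y)

lemma commute_fwd {a : 𝒜} {L : List ι} (h : ∀ k ∈ L, Commute a (u k)) (y : R) :
    Commute a (fwd u L y) := by
  induction L with
  | nil => exact Commute.one_right a
  | cons i L ih =>
    rw [fwd_cons]
    exact (commute_factor (h i (by simp)) y).mul_right (ih fun k hk => h k (by simp [hk]))

lemma commute_bwd {a : 𝒜} {L : List ι} (h : ∀ k ∈ L, Commute a (u k)) (y : R) :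
    Commute a (bwd u L y) := by
  induction L with
  | nil => exact Commute.one_right a
  | cons i L ih =>
    rw [bwd_cons]
    exact (ih fun k hk => h k (by simp [hk])).mul_right (commute_factor (h i (by simp)) y)

lemma commute_stair {a : 𝒜} {L : List ι} (h : ∀ k ∈ L, Commute a (u k)) (y : ℕ → R) :
    Commute a (stair u L y) := by
  induction L generalizing y with
  | nil => exact Commute.one_right a
  | cons i L ih =>
    exact (commute_bwd h _).mul_right (ih (fun k hk => h k (by simp [hk])) _)

lemma commute_factor_factor {i j : ι} (h : Commute (u i) (u j)) (y z : R) :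
    Commute (factor u y i) (factor u z j) :=
  commute_factor (commute_factor h.symm y).symm z

variable {β}

lemma factor_mul_factor {i : ι} (hsq : u i * u i = β • u i) (y z : R) :
    factor u y i * factor u z i = factor u (oplus β y z) i := by
  simp only [factor, oplus, mul_add, add_mul, one_mul, mul_one, smul_mul_assoc, mul_smul_comm,
    hsq]
  module

lemma factor_braid (hsq : ∀ i, u i * u i = β • u i) {i j : ι}
    (hb : u i * u j * u i = u j * u i * u j) (y z : R) :
    factor u y i * factor u (oplus β y z) j * factor u z i =
      factor u z j * factor u (oplus β y z) i * factor u y j := by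
  simp only [factor, oplus, mul_add, add_mul, one_mul, mul_one, smul_mul_assoc, mul_smul_comm,
    hsq, hb]
  module

/-- The Yang–Baxter identity for a path. -/
lemma fwd_mul_bwd (hsq : ∀ i, u i * u i = β • u i) {i : ι} {L : List ι}
    (hL : IsPath u (i :: L)) (y z : R) :
    fwd u (i :: L) y * bwd u (i :: L) z =
      bwd u L z * factor u (oplus β y z) i * fwd u L y := by
  induction L generalizing i with
  | nil => simp [fwd_cons, bwd_cons, factor_mul_factor (hsq i)]
  | cons j L ih =>
    obtain ⟨hb, hc, hL'⟩ := hL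
    have c₁ : Commute (factor u y i) (bwd u L z) :=
      commute_bwd (fun k hk => (commute_factor (hc k hk).symm y).symm) z
    have c₂ : Commute (factor u z i) (fwd u L y) :=
      commute_fwd (fun k hk => (commute_factor (hc k hk).symm z).symm) y
    calc fwd u (i :: j :: L) y * bwd u (i :: j :: L) z
        = factor u y i * (fwd u (j :: L) y * bwd u (j :: L) z) * factor u z i := by
          rw [fwd_cons i, bwd_cons i]; simp only [mul_assoc]
      _ = factor u y i * bwd u L z * factor u (oplus β y z) j *
            (fwd u L y * factor u z i) := by
          rw [ih hL']; simp only [mul_assoc]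
      _ = bwd u L z * (factor u y i * factor u (oplus β y z) j * factor u z i) *
            fwd u L y := by
          rw [c₁.eq, ← c₂.eq]; simp only [mul_assoc]
      _ = bwd u (j :: L) z * factor u (oplus β y z) i * fwd u (j :: L) y := by
          rw [factor_braid hsq hb, fwd_cons j, bwd_cons j]; simp only [mul_assoc]

/-- `fwd_mul_bwd` passes the increasing product through one column and splits off one factor. That
factor is at `i`, and commutes with the remaining columns because they avoid the neighbour of `i`.
-/
lemma fwd_mul_stair (hsq : ∀ i, u i * u i = β • u i) {L : List ι}
    (hL : IsPath u L) (x : R) (y : ℕ → R) :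
    fwd u L x * stair u L y = stair u L.tail y * row u L fun k => oplus β x (y k) := by
  induction L generalizing y with
  | nil => simp [stair, row]
  | cons i L ih =>
    have c : Commute (factor u (oplus β x (y 0)) i) (stair u L.tail fun k => y (k + 1)) := by
      apply commute_stair
      intro k hk
      cases L with
      | nil => simp at hk
      | cons j L => exact (commute_factor (hL.2.1 k hk).symm _).symm
    rw [stair, ← mul_assoc, fwd_mul_bwd hsq hL, mul_assoc, ih hL.tail, row, List.tail_cons,
      stair_eq L y, mul_assoc (bwd u L (y 0)), ← mul_assoc _ (stair u L.tail _), c.eq]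
    simp only [mul_assoc]

section Swap

/-- `1 + β x` times the factor with parameter `y ⊖ x`. -/
def swapFactor (β : R) (u : ι → 𝒜) (x y : R) (i : ι) : 𝒜 := (1 + β * x) • 1 + (y - x) • u i

lemma commute_swapFactor {a : 𝒜} {i : ι} (h : Commute a (u i)) (x y : R) :
    Commute a (swapFactor β u x y i) :=
  ((Commute.one_right a).smul_right _).add_right (h.smul_right _)

/-- Each step is Yang–Baxter with parameters `x`, `y` and `y ⊖ x`, since `x ⊕ (y ⊖ x) = y`. The
scalar `1 + β x` clears the denominator of `y ⊖ x`. -/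
lemma bwd_mul_swapFactor (hsq : ∀ i, u i * u i = β • u i) {i : ι} {L : List ι}
    (hL : IsPath u (i :: L)) (x y : R) :
    bwd u (i :: L) x * bwd u L y * swapFactor β u x y i =
      (1 + β * x) • (bwd u (i :: L) y * bwd u L x) := by
  induction L generalizing i with
  | nil =>
    simp only [bwd_cons, bwd_nil, one_mul, mul_one, factor, swapFactor, mul_add, add_mul,
      smul_mul_assoc, mul_smul_comm, hsq]
    module
  | cons j L ih =>
    obtain ⟨hb, hc, hL'⟩ := hL
    have c : ∀ x y : R, Commute (factor u x i) (bwd u L y) := fun x y =>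
      commute_bwd (fun k hk => (commute_factor (hc k hk).symm x).symm) y
    have hy : factor u x i * factor u y j * swapFactor β u x y i =
        swapFactor β u x y j * (factor u y i * factor u x j) := by
      simp only [factor, swapFactor, mul_add, add_mul, one_mul, mul_one, smul_mul_assoc,
        mul_smul_comm, hsq, ← mul_assoc, hb]
      module
    calc bwd u (i :: j :: L) x * bwd u (j :: L) y * swapFactor β u x y i
        = bwd u (j :: L) x * (factor u x i * bwd u L y) * factor u y j *
            swapFactor β u x y i := by
          rw [bwd_cons i, bwd_cons j L y]; simp only [mul_assoc]
      _ = bwd u (j :: L) x * bwd u L y * (factor u x i * factor u y j *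
            swapFactor β u x y i) := by
          rw [(c x y).eq]; simp only [mul_assoc]
      _ = (bwd u (j :: L) x * bwd u L y * swapFactor β u x y j) *
            (factor u y i * factor u x j) := by
          rw [hy]; simp only [mul_assoc]
      _ = (1 + β * x) • (bwd u (j :: L) y * (bwd u L x * factor u y i) * factor u x j) := by
          rw [ih hL', smul_mul_assoc]; simp only [mul_assoc]
      _ = (1 + β * x) • (bwd u (i :: j :: L) y * bwd u (j :: L) x) := by
          rw [← (c y x).eq, bwd_cons i, bwd_cons j L x]; simp only [mul_assoc]

lemma swapFactor_mul_fwd (hsq : ∀ i, u i * u i = β • u i) {i : ι} {L : List ι}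
    (hL : IsPath u (i :: L)) (x y : R) :
    swapFactor β u x y i * (fwd u L y * fwd u (i :: L) x) =
      (1 + β * x) • (fwd u L x * fwd u (i :: L) y) := by
  induction L generalizing i with
  | nil =>
    simp only [fwd_cons, fwd_nil, one_mul, mul_one, factor, swapFactor, mul_add, add_mul,
      smul_mul_assoc, mul_smul_comm, hsq]
    module
  | cons j L ih =>
    obtain ⟨hb, hc, hL'⟩ := hL
    have c : ∀ x y : R, Commute (factor u x i) (fwd u L y) := fun x y =>
      commute_fwd (fun k hk => (commute_factor (hc k hk).symm x).symm) y
    have hy : swapFactor β u x y i * (factor u y j * factor u x i) =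
        factor u x j * factor u y i * swapFactor β u x y j := by
      simp only [factor, swapFactor, mul_add, add_mul, one_mul, mul_one, smul_mul_assoc,
        mul_smul_comm, hsq, ← mul_assoc, hb]
      module
    calc swapFactor β u x y i * (fwd u (j :: L) y * fwd u (i :: j :: L) x)
        = swapFactor β u x y i * (factor u y j * (fwd u L y * factor u x i) *
            fwd u (j :: L) x) := by
          rw [fwd_cons i, fwd_cons j L y]; simp only [mul_assoc]
      _ = swapFactor β u x y i * (factor u y j * factor u x i) *
            (fwd u L y * fwd u (j :: L) x) := by
          rw [← (c x y).eq]; simp only [mul_assoc]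
      _ = factor u x j * factor u y i *
            (swapFactor β u x y j * (fwd u L y * fwd u (j :: L) x)) := by
          rw [hy]; simp only [mul_assoc]
      _ = (1 + β * x) • (factor u x j * (factor u y i * fwd u L x) * fwd u (j :: L) y) := by
          rw [ih hL', mul_smul_comm]; simp only [mul_assoc]
      _ = (1 + β * x) • (fwd u (j :: L) x * fwd u (i :: j :: L) y) := by
          rw [(c y x).eq, fwd_cons i, fwd_cons j L x]; simp only [mul_assoc]

end Swap

section Fork

variable (u) in
/-- The product over the list, the two forked ends and back. -/
def forkElt (e e' : ι) (L : List ι) (x : R) : 𝒜 := bwd u (e' :: L) x * fwd u (e :: L) x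

lemma forkElt_symm {e e' : ι} (L : List ι) (hc : Commute (u e) (u e')) (x : R) :
    forkElt u e e' L x = forkElt u e' e L x := by
  simp only [forkElt, bwd_cons, fwd_cons]
  rw [mul_assoc, ← mul_assoc (factor u x e'), (commute_factor_factor hc x x).symm.eq]
  simp only [mul_assoc]

/-- One step of the exchange of a fork element with a staircase. -/
lemma forkElt_mul_stair (hsq : ∀ i, u i * u i = β • u i) {e e' : ι} {L : List ι}
    (hL : IsPath u (e :: L)) {x : R} {y z : ℕ → R} (hz : z 0 = x)
    (hz' : ∀ k, z (k + 1) = y k) :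
    forkElt u e e' L x * stair u (e :: L) y =
      stair u (e' :: L) z * row u (e :: L) fun k => oplus β x (y k) := by
  rw [forkElt, mul_assoc, fwd_mul_stair hsq hL, ← mul_assoc, stair, hz]
  simp only [hz', List.tail_cons]

/-- Yang–Baxter along the path of `e` leaves a central factor at `e` with the symmetric parameter `x
⊕ y`. A swap factor at `e'` commutes with it; drawn out of the right part and absorbed on the left,
it exchanges `x` and `y`. -/
lemma smul_forkElt_mul_forkElt (hsq : ∀ i, u i * u i = β • u i) {e e' : ι} {L : List ι}
    (hL : IsPath u (e :: L)) (hL' : IsPath u (e' :: L)) (hc : Commute (u e) (u e')) (x y : R) :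
    (1 + β * x) • (forkElt u e e' L x * forkElt u e e' L y) =
      (1 + β * x) • (forkElt u e e' L y * forkElt u e e' L x) := by
  have key : ∀ x y : R, forkElt u e e' L x * forkElt u e e' L y =
      bwd u (e' :: L) x * bwd u L y * factor u (oplus β x y) e *
        (fwd u L x * fwd u (e' :: L) y) := by
    intro x y
    rw [forkElt_symm L hc y, forkElt, forkElt, mul_assoc, ← mul_assoc (fwd u (e :: L) x),
      fwd_mul_bwd hsq hL]
    simp only [mul_assoc]
  have c : Commute (factor u (oplus β x y) e) (swapFactor β u x y e') :=
    commute_swapFactor (commute_factor hc.symm _).symm x y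
  have hxy : oplus β y x = oplus β x y := by simp only [oplus]; ring
  rw [key x y, key y x, hxy, ← mul_smul_comm, ← swapFactor_mul_fwd hsq hL']
  simp only [← mul_assoc]
  rw [mul_assoc _ (factor u (oplus β x y) e), c.eq, ← mul_assoc, bwd_mul_swapFactor hsq hL']
  simp only [smul_mul_assoc, mul_assoc]

end Fork

end Algebra

/-! ### Commutativity of the fork elements -/

section Polynomial

open Polynomial

variable {R 𝒜 ι : Type*} [CommRing R] [Ring 𝒜] [Algebra R 𝒜] {β : R} {u : ι → 𝒜}

attribute [local instance] Polynomial.algebra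

lemma map_factor {S ℬ : Type*} [CommRing S] [Ring ℬ] [Algebra S ℬ] (φ : ℬ →+* 𝒜) (v : ι → ℬ)
    (s : S) (y : R) (hv : ∀ i, φ (v i) = u i)
    (hs : φ (algebraMap S ℬ s) = algebraMap R 𝒜 y) (i : ι) :
    φ (factor v s i) = factor u y i := by
  rw [factor, factor, Algebra.smul_def, Algebra.smul_def, map_add, map_one, map_mul, hv, hs]

lemma map_forkElt {S ℬ : Type*} [CommRing S] [Ring ℬ] [Algebra S ℬ] (φ : ℬ →+* 𝒜) (v : ι → ℬ)
    (s : S) (y : R) (hv : ∀ i, φ (v i) = u i)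
    (hs : φ (algebraMap S ℬ s) = algebraMap R 𝒜 y) (e e' : ι) (L : List ι) :
    φ (forkElt v e e' L s) = forkElt u e e' L y := by
  have : ⇑φ ∘ factor v s = factor u y := funext (map_factor φ v s y hv hs)
  rw [forkElt, forkElt, map_mul, bwd, bwd, fwd, fwd, map_list_prod, map_list_prod, List.map_map,
    List.map_map, this]

/-- The constant coefficient vanishes, and each coefficient is determined by the previous one. For
an indeterminate the scalar thus cancels, while `1 + β x` in `R` might be a zero divisor. -/
lemma eq_zero_of_one_add_smul_eq_zero (P : 𝒜[X])
    (h : ((1 : R[X]) + C β * X) • P = 0) : P = 0 := by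
  have h' : P + C (algebraMap R 𝒜 β) * (X * P) = 0 := by
    rw [Algebra.smul_def] at h
    simpa [Polynomial.algebraMap_def, add_mul, mul_assoc] using h
  ext n
  induction n with
  | zero => simpa using congrArg (coeff · 0) h'
  | succ n ih =>
    have := congrArg (coeff · (n + 1)) h'
    simp only [coeff_add, coeff_C_mul, coeff_X_mul, ih] at this
    simpa using this

/-- The fork elements commute. -/
lemma commute_forkElt (hsq : ∀ i, u i * u i = β • u i) {e e' : ι} {L : List ι}
    (hL : IsPath u (e :: L)) (hL' : IsPath u (e' :: L)) (hc : Commute (u e) (u e')) (x y : R) :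
    Commute (forkElt u e e' L x) (forkElt u e e' L y) := by
  have hpath : ∀ L : List ι, IsPath u L → IsPath (fun i => (C (u i) : 𝒜[X])) L := by
    intro L
    induction L with
    | nil => exact fun _ => trivial
    | cons i L ih =>
      cases L with
      | nil => exact fun _ => trivial
      | cons j L =>
        rintro ⟨h₁, h₂, h₃⟩
        refine ⟨by simp only [← C_mul, h₁], fun k hk => ?_, ih h₃⟩
        exact (h₂ k hk).map (C : 𝒜 →+* 𝒜[X])
  have hsq' : ∀ i, (C (u i) : 𝒜[X]) * C (u i) = (C β : R[X]) • C (u i) := by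
    intro i
    rw [Algebra.smul_def, Polynomial.algebraMap_def, coe_mapRingHom, map_C, ← C_mul, ← C_mul,
      hsq, Algebra.smul_def]
  have h := smul_forkElt_mul_forkElt (β := (C β : R[X])) hsq' (hpath _ hL) (hpath _ hL')
    (hc.map (C : 𝒜 →+* 𝒜[X])) X (C y)
  rw [← sub_eq_zero, ← smul_sub] at h
  have h' := sub_eq_zero.1 (eq_zero_of_one_add_smul_eq_zero _ h)
  -- Specializing `X` to `x` is multiplicative because scalars are central.
  let φ : 𝒜[X] →+* 𝒜 := eval₂RingHom' (RingHom.id 𝒜) (algebraMap R 𝒜 x)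
    fun a => (Algebra.commutes x a).symm
  have hφC : ∀ a, φ (C a) = a := fun a => eval₂_C _ _
  have hφX : φ X = algebraMap R 𝒜 x := eval₂_X _ _
  have := congrArg φ h'
  rw [map_mul, map_mul, map_forkElt (u := u) φ _ _ x (fun i => hφC _),
    map_forkElt (u := u) φ _ _ y (fun i => hφC _)] at this
  · exact this
  · rw [Polynomial.algebraMap_def]; simp [hφC]
  · rw [Polynomial.algebraMap_def]; simp [hφX]

end Polynomial

end GrothD

/-! ### Staircases, triangles and rows -/

namespace GrothD

open List

section Triangle

variable {R 𝒜 ι : Type*} [CommRing R] [Ring 𝒜] [Algebra R 𝒜] {β : R} {u : ι → 𝒜}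

lemma oplus_comm (y z : R) : oplus β y z = oplus β z y := by
  simp only [oplus]; ring

lemma oplus_ominus {y : R} (hy : IsUnit (1 + β * y)) : oplus β y (ominus β y) = 0 := by
  have := Ring.mul_inverse_cancel _ hy
  simp only [oplus, ominus]
  linear_combination (-y) * this

lemma factor_zero (i : ι) : factor u (0 : R) i = 1 := by simp [factor]

lemma fwd_zero (L : List ι) : fwd u L (0 : R) = 1 := by
  induction L with
  | nil => rfl
  | cons i L ih => rw [fwd_cons, ih, factor_zero, one_mul]

lemma bwd_ominus_mul_fwd (hsq : ∀ i, u i * u i = β • u i) (L : List ι) {y : R}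
    (hy : IsUnit (1 + β * y)) : bwd u L (ominus β y) * fwd u L y = 1 := by
  induction L with
  | nil => simp
  | cons i L ih =>
    rw [bwd_cons, fwd_cons, mul_assoc, ← mul_assoc (factor u _ i), factor_mul_factor (hsq i),
      oplus_comm, oplus_ominus hy, factor_zero, one_mul, ih]

lemma fwd_mul_bwd_ominus (hsq : ∀ i, u i * u i = β • u i) (L : List ι) {y : R}
    (hy : IsUnit (1 + β * y)) : fwd u L y * bwd u L (ominus β y) = 1 := by
  induction L with
  | nil => simp
  | cons i L ih =>
    rw [bwd_cons, fwd_cons, mul_assoc, ← mul_assoc (fwd u L y), ih, one_mul,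
      factor_mul_factor (hsq i), oplus_ominus hy, factor_zero]

variable (u) in
/-- The inverse of a staircase. -/
def invStair : List ι → (ℕ → R) → 𝒜
  | [], _ => 1
  | i :: L, b => invStair L (fun k => b (k + 1)) * fwd u (i :: L) (b 0)

variable (β u) in
/-- The triangular product of rows with parameters `b_k ⊕ c_l`. -/
def triangle : List ι → (ℕ → R) → (ℕ → R) → 𝒜
  | [], _, _ => 1
  | i :: L, b, c => triangle L (fun k => b (k + 1)) c * row u (i :: L) fun k => oplus β (b 0) (c k)

lemma stair_mul_invStair (hsq : ∀ i, u i * u i = β • u i) (L : List ι) {b : ℕ → R}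
    (hb : ∀ k, IsUnit (1 + β * b k)) :
    stair u L (fun k => ominus β (b k)) * invStair u L b = 1 := by
  induction L generalizing b with
  | nil => simp [stair, invStair]
  | cons i L ih =>
    rw [stair, invStair, mul_assoc, ← mul_assoc (stair u L _), ih fun k => hb (k + 1), one_mul,
      bwd_ominus_mul_fwd hsq _ (hb 0)]

lemma invStair_mul_stair (hsq : ∀ i, u i * u i = β • u i) (L : List ι) {b : ℕ → R}
    (hb : ∀ k, IsUnit (1 + β * b k)) :
    invStair u L b * stair u L (fun k => ominus β (b k)) = 1 := by
  induction L generalizing b with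
  | nil => simp [stair, invStair]
  | cons i L ih =>
    rw [stair, invStair, mul_assoc, ← mul_assoc (fwd u _ _), fwd_mul_bwd_ominus hsq _ (hb 0),
      one_mul, ih fun k => hb (k + 1)]

lemma inverse_stair (hsq : ∀ i, u i * u i = β • u i) (L : List ι) {b : ℕ → R}
    (hb : ∀ k, IsUnit (1 + β * b k)) :
    Ring.inverse (stair u L fun k => ominus β (b k)) = invStair u L b :=
  Ring.inverse_unit ⟨_, _, stair_mul_invStair hsq L hb, invStair_mul_stair hsq L hb⟩

lemma invStair_mul_stair_eq_triangle (hsq : ∀ i, u i * u i = β • u i) {L : List ι}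
    (hL : IsPath u L) (b c : ℕ → R) :
    invStair u L b * stair u L c = triangle β u L b c := by
  induction L generalizing b with
  | nil => simp [stair, invStair, triangle]
  | cons i L ih =>
    rw [invStair, mul_assoc, fwd_mul_stair hsq hL, List.tail_cons, ← mul_assoc, ih hL.tail,
      triangle]

lemma stair_eq_prod (L : List ι) (y : ℕ → R) :
    stair u L y = ((range L.length).map fun i => bwd u (L.drop i) (y i)).prod := by
  induction L generalizing y with
  | nil => rfl
  | cons i L ih =>
    rw [stair, ih, length_cons, range_succ_eq_map, map_cons, prod_cons, map_map]
    rfl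

lemma prod_map_mapIdx (wt : ℕ × ℕ → R) (g : ℕ → ℕ × ℕ) (L : List ι) :
    (((L.mapIdx fun c k => (k, g c)).map fun d => factor u (wt d.2) d.1)).prod =
      row u L fun c => wt (g c) := by
  induction L generalizing g with
  | nil => rfl
  | cons i L ih =>
    rw [mapIdx_cons, map_cons, prod_cons, row, ih fun c => g (c + 1)]

/-- A product of commuting fork elements times a staircase. -/
lemma prod_forkElt_mul_stair (hsq : ∀ i, u i * u i = β • u i) {e : ℕ → ι} {L : List ι}
    (he : ∀ k, e (k + 2) = e k)
    (hL : ∀ k, IsPath u (e k :: L)) (hc : Commute (u (e 0)) (u (e 1))) (x : ℕ → R)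
    (y : ℕ → ℕ → R) (n : ℕ) (h0 : ∀ k < n, y (k + 1) 0 = x k)
    (h1 : ∀ k < n, ∀ i, y (k + 1) (i + 1) = y k i) :
    ((range n).map fun k => forkElt u (e 0) (e 1) L (x k)).prod * stair u (e 0 :: L) (y 0) =
      stair u (e n :: L) (y n) *
        ((range n).reverse.map fun k => row u (e k :: L) fun i => oplus β (x k) (y k i)).prod := by
  have hcomm : ∀ k l, Commute (forkElt u (e 0) (e 1) L (x k)) (forkElt u (e 0) (e 1) L (x l)) :=
    fun k l => commute_forkElt hsq (hL 0) (hL 1) hc _ _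
  -- The two ends may be interchanged in a fork element, so each fork can be written to start its
  -- increasing half at the current end of the staircase.
  have hfork : ∀ k (z : R), forkElt u (e 0) (e 1) L z = forkElt u (e k) (e (k + 1)) L z := by
    intro k z
    have : (e k = e 0 ∧ e (k + 1) = e 1) ∨ (e k = e 1 ∧ e (k + 1) = e 0) := by
      induction k with
      | zero => simp
      | succ k ih => rcases ih with ⟨h₁, h₂⟩ | ⟨h₁, h₂⟩ <;> simp [he, h₁, h₂]
    rcases this with ⟨h₁, h₂⟩ | ⟨h₁, h₂⟩
    · rw [h₁, h₂]
    · rw [h₁, h₂, forkElt_symm L hc]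
  induction n with
  | zero => simp
  | succ n ih =>
    -- Moving the last fork to the front makes it act last, so its row stands leftmost. This is why
    -- the rows appear in reverse order.
    have hcn : Commute ((range n).map fun k => forkElt u (e 0) (e 1) L (x k)).prod
        (forkElt u (e 0) (e 1) L (x n)) := by
      apply Commute.list_prod_left
      intro z hz
      obtain ⟨k, -, rfl⟩ := mem_map.1 hz
      exact hcomm k n
    rw [range_succ, map_append, prod_append, map_singleton, prod_singleton, hcn.eq, mul_assoc,
      ih (fun k hk => h0 k (by omega)) (fun k hk => h1 k (by omega)), ← mul_assoc, hfork n,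
      forkElt_mul_stair hsq (hL n) (h0 n (by omega)) (h1 n (by omega)), reverse_append,
      map_append, prod_append, mul_assoc]
    simp

end Triangle

/-! ### Factorization of the generating function for even `n` -/

section TypeD

variable {R : Type*} [CommRing R] {β : R}

lemma coxD_apply {n : ℕ} (i j : Fin n) :
    coxD n i j = if i = j then 1 else if DEdge i j ∨ DEdge j i then 3 else 2 := rfl

lemma coxD_simplyLaced (n : ℕ) : (coxD n).SimplyLaced := by
  intro i j hij
  rw [coxD_apply, if_neg hij]
  split_ifs <;> simp

lemma uGen_braid {n : ℕ} {i j : Fin n} (h : DEdge i j) :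
    uGen (coxD n) β i * uGen (coxD n) β j * uGen (coxD n) β i =
      uGen (coxD n) β j * uGen (coxD n) β i * uGen (coxD n) β j := by
  have hij : i ≠ j := by
    rintro rfl
    unfold DEdge at h
    omega
  have := prod_map_uGen_braid (M := coxD n) (β := β) j i
  rw [(coxD n).symmetric j i, coxD_apply, if_neg hij, if_pos (Or.inl h)] at this
  simpa [CoxeterSystem.alternatingWord, mul_assoc] using this

lemma commute_uGen {n : ℕ} {i j : Fin n} (h₁ : ¬ DEdge i j) (h₂ : ¬ DEdge j i) :
    Commute (uGen (coxD n) β i) (uGen (coxD n) β j) := by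
  by_cases hij : i = j
  · rw [hij]
  have := prod_map_uGen_braid (M := coxD n) (β := β) i j
  rw [coxD_apply, if_neg hij, if_neg (by tauto)] at this
  simpa [CoxeterSystem.alternatingWord, Commute, SemiconjBy] using this

lemma le_of_mem_drop_finRange {n i : ℕ} {k : Fin n} (h : k ∈ (finRange n).drop i) : i ≤ k := by
  obtain ⟨j, hj, rfl⟩ := getElem_of_mem h
  simp

lemma drop_finRange {n i : ℕ} (h : i < n) :
    (finRange n).drop i = ⟨i, h⟩ :: (finRange n).drop (i + 1) := by
  rw [drop_eq_getElem_cons (by simpa using h)]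
  simp

lemma isPath_cons_drop {n i j : ℕ} (hi : i < n) (hij : DEdge i j)
    (hj : ∀ k, j < k → ¬ DEdge i k ∧ ¬ DEdge k i)
    (h : IsPath (uGen (coxD n) β) ((finRange n).drop j)) :
    IsPath (uGen (coxD n) β) (⟨i, hi⟩ :: (finRange n).drop j) := by
  by_cases hjn : j < n
  · rw [drop_finRange hjn] at h ⊢
    refine ⟨uGen_braid hij, fun k hk => ?_, h⟩
    have := hj k (le_of_mem_drop_finRange hk)
    exact commute_uGen this.1 this.2
  · rw [drop_of_length_le (by simpa using hjn)]
    trivial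

lemma isPath_drop {n i : ℕ} (hi : 1 ≤ i) :
    IsPath (uGen (coxD n) β) ((finRange n).drop i) := by
  by_cases hin : i < n
  · rw [drop_finRange hin]
    refine isPath_cons_drop hin (Or.inl ⟨hi, rfl⟩) (fun k hk => ?_)
      (isPath_drop (by omega : 1 ≤ i + 1))
    unfold DEdge
    omega
  · rw [drop_of_length_le (by simpa using hin)]
    trivial
termination_by n - i

lemma isPath_zero_cons_drop (m : ℕ) :
    IsPath (uGen (coxD (m + 2)) β) (0 :: (finRange (m + 2)).drop 2) := by
  refine isPath_cons_drop (i := 0) (by omega) (Or.inr ⟨rfl, rfl⟩) (fun k hk => ?_) (isPath_drop (by omega))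
  unfold DEdge
  omega

lemma drop_one_finRange (m : ℕ) :
    (finRange (m + 2)).drop 1 = 1 :: (finRange (m + 2)).drop 2 :=
  drop_finRange (by omega)

lemma finRange_add_two (m : ℕ) :
    finRange (m + 2) = 0 :: 1 :: (finRange (m + 2)).drop 2 := by
  rw [← drop_one_finRange]
  exact drop_finRange (i := 0) (by omega)

lemma isPath_one_cons_drop (m : ℕ) :
    IsPath (uGen (coxD (m + 2)) β) (1 :: (finRange (m + 2)).drop 2) := by
  rw [← drop_one_finRange]
  exact isPath_drop le_rfl

lemma GA_eq_stair (n : ℕ) (y : ℕ → R) :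
    GA n β y = stair (uGen (coxD n) β) ((finRange n).drop 1) fun k => y (k + 1) := by
  rw [stair_eq_prod, length_drop, length_finRange]
  simp only [drop_drop, GA, A, add_comm 1]
  rfl

lemma FD_eq_forkElt (m : ℕ) (y : R) :
    FD (m + 2) β y = forkElt (uGen (coxD (m + 2)) β) 1 0 ((finRange (m + 2)).drop 2) y := by
  have h2 : (finRange (m + 2)).take 2 = [0, 1] := by
    rw [finRange_add_two]; rfl
  rw [FD, h2, forkElt, bwd_cons, fwd_cons, mul_assoc, mul_assoc, ← mul_assoc (factor _ _ _)]
  congr 2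
  simp [hProd, factor, h]

lemma filter_finRange (m t : ℕ) :
    (finRange (m + 2)).filter (fun k : Fin (m + 2) => k.val = t % 2 ∨ 2 ≤ k.val) =
      (if Even t then 0 else 1) :: (finRange (m + 2)).drop 2 := by
  have hT : ((finRange (m + 2)).drop 2).filter
      (fun k : Fin (m + 2) => k.val = t % 2 ∨ 2 ≤ k.val) = (finRange (m + 2)).drop 2 := by
    rw [filter_eq_self]
    intro k hk
    simp [le_of_mem_drop_finRange hk]
  conv_lhs => rw [finRange_add_two]
  rw [filter_cons, filter_cons, hT]
  rcases Nat.even_or_odd t with ht | ht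
  · simp [ht, Nat.even_iff.1 ht]
  · simp [Nat.not_even_iff_odd.2 ht, Nat.odd_iff.1 ht]

lemma triangle_eq_prod (n : ℕ) (a b x : ℕ → R) (r : ℕ) (hr : r + 1 ≤ n) :
    ((range r).map fun s => row (uGen (coxD n) β) ((finRange n).drop (n - (s + 1)))
      fun c => wtD n β a b x (c + 1, 2 * n - (s + 1))).prod =
    triangle β (uGen (coxD n) β) ((finRange n).drop (n - r)) (fun k => b (n - r + k))
      fun k => p n a x (k + 1) := by
  induction r with
  | zero =>
    rw [drop_of_length_le (by simp)]
    rfl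
  | succ r ih =>
    rw [range_succ, map_append, prod_append, map_singleton, prod_singleton, ih (by omega),
      drop_finRange (i := n - (r + 1)) (by omega), triangle]
    have e : n - (r + 1) + 1 = n - r := by omega
    rw [e]
    congr 1
    · congr 1
      funext k
      congr 1
      omega
    · congr 1
      funext c
      rw [wtD, oplus_comm, q, if_neg (by simp; omega)]
      congr 2
      simp
      omega

lemma prod_flatMap {A G : Type*} [Monoid G] (l : List A) (f : A → List G) :
    (l.flatMap f).prod = (l.map fun x => (f x).prod).prod := by
  induction l with
  | nil => rfl
  | cons x l ih => rw [flatMap_cons, prod_append, ih, map_cons, prod_cons]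

lemma reverse_range_map {A : Type*} (n : ℕ) (f : ℕ → A) :
    (range n).reverse.map f = (range n).map fun t => f (n - 1 - t) := by
  apply List.ext_getElem
  · simp
  · intro k h₁ h₂
    simp

/-- The generating function for even `n` is the product of the factors along `Δ_n^D`. -/
theorem genD_eq_prod {a b x : ℕ → R} (hb : ∀ j, IsUnit (1 + β * b j)) {n : ℕ} (hn : 2 ≤ n)
    (he : Even n) :
    genD n β a b x =
      ((deltaD n).map fun d => h (coxD n) β (wtD n β a b x d.2) d.1).prod := by
  obtain ⟨m, rfl⟩ := Nat.exists_eq_add_of_le' hn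
  let u := uGen (coxD (m + 2)) β
  have hsq : ∀ i, u i * u i = β • u i := uGen_mul_self
  let T := (finRange (m + 2)).drop 2
  -- The end of the staircase after `k` forks: index `1` is `s_1`, index `0` is `s_{1̂}`.
  let e : ℕ → Fin (m + 2) := fun k => if Even k then 1 else 0
  -- Its parameters after `k ≤ n` forks: `x_k, …, x_1, a_1, a_2, …`.
  let y : ℕ → ℕ → R := fun k i => p (m + 2) a x (m + 2 - k + 1 + i)
  have hpath : ∀ k, IsPath u (e k :: T) := by
    intro k
    by_cases hk : Even k
    · simpa [e, hk] using isPath_one_cons_drop m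
    · simpa [e, hk] using isPath_zero_cons_drop m
  have hc : Commute (u (e 0)) (u (e 1)) := by
    simp only [e, Even.zero, Nat.not_even_one, if_true, if_false]
    exact commute_uGen (by simp [DEdge]) (by simp [DEdge])
  have hrows := prod_forkElt_mul_stair (β := β) hsq (e := e) (L := T)
    (fun k => by simp [e, Nat.even_add]) hpath hc (fun k => x (k + 1)) y (m + 2)
    (fun k hk => by
      simp only [y, p]
      rw [if_pos (by omega)]
      congr 1
      omega)
    (fun k hk i => by
      simp only [y]
      congr 1
      omega)
  have hGa : GA (m + 2) β a = stair u (e 0 :: T) (y 0) := by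
    rw [GA_eq_stair, drop_one_finRange]
    congr 1
    funext k
    simp only [y, p]
    rw [if_neg (by omega)]
    congr 1
    omega
  -- Evenness of `n` brings the staircase back to the path `1, 2, …, n-1`, where it meets the
  -- inverse of `G_A(⊖b)`.
  have hen : e (m + 2) = 1 := by simp [e, he]
  have hyn : y (m + 2) = fun k => p (m + 2) a x (k + 1) := by
    funext k
    simp only [y]
    congr 1
    omega
  have htri := triangle_eq_prod (β := β) (m + 2) a b x (m + 1) (by omega)
  rw [show m + 2 - (m + 1) = 1 by omega] at htri
  have hF : ∀ z, FD (m + 2) β z = forkElt u (e 0) (e 1) T z := fun z => FD_eq_forkElt m z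
  rw [genD, GA_eq_stair, inverse_stair hsq _ (fun k => hb (k + 1)), mul_assoc, hGa]
  simp only [hF]
  rw [hrows, hen, hyn, ← drop_one_finRange, ← mul_assoc,
    invStair_mul_stair_eq_triangle hsq (isPath_drop le_rfl)]
  simp only [add_comm 1] at htri
  rw [← htri, deltaD, map_append, prod_append, map_flatMap, map_flatMap, prod_flatMap,
    prod_flatMap]
  congr 1
  · congr 1
    apply map_congr_left
    intro r _
    exact (prod_map_mapIdx (u := u) _ (fun c => (c + 1, 2 * (m + 2) - (r + 1))) _).symm
  · rw [reverse_range_map]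
    congr 1
    apply map_congr_left
    intro t ht
    rw [mem_range] at ht
    rw [filter_finRange]
    refine Eq.trans ?_
      (prod_map_mapIdx (u := u) _ (fun c => (t + 2 + c, m + 2 - t)) _).symm
    -- Row `t` comes from the fork numbered `n-1-t` from `0`. As `n` is even, this number and `t`
    -- have opposite parity.
    have het : e (m + 2 - 1 - t) = if Even t then 0 else 1 := by
      simp only [e]
      have : Even (m + 2 - 1 - t) ↔ ¬ Even t := by
        have h₁ : Even (m + 2 - 1 - t + t + 1) := by
          rwa [show m + 2 - 1 - t + t + 1 = m + 2 by omega]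
        simp only [Nat.even_add_one, Nat.even_add] at h₁
        tauto
      by_cases h : Even t
      · rw [if_pos h, if_neg (fun h' => this.1 h' h)]
      · rw [if_neg h, if_pos (this.2 h)]
    rw [het]
    congr 1
    funext c
    rw [wtD, oplus_comm, q, if_pos (by simp)]
    simp only [y]
    congr 2 <;> omega

end TypeD

end GrothD

/-! ### Restriction from `D_{n+1}` to `D_n` -/

namespace GrothD

open List

section Restriction

variable {R : Type*} [CommRing R] {β : R}

lemma coxD_castSucc {n : ℕ} (i j : Fin n) : coxD (n + 1) i.castSucc j.castSucc = coxD n i j := by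
  simp [coxD_apply]

variable (β) in
/-- The generators of the idCoxeter algebra of type `D_n`, extended by zero. -/
def extGen (n : ℕ) : Fin (n + 1) → IdCox (coxD n) β :=
  Fin.lastCases 0 (uGen (coxD n) β)

@[simp] lemma extGen_castSucc {n : ℕ} (i : Fin n) :
    extGen β n i.castSucc = uGen (coxD n) β i := by simp [extGen]

@[simp] lemma extGen_last (n : ℕ) : extGen β n (Fin.last n) = 0 := by simp [extGen]

lemma extGen_mul_self {n : ℕ} (i : Fin (n + 1)) :
    extGen β n i * extGen β n i = β • extGen β n i := by
  induction i using Fin.lastCases with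
  | last => simp
  | cast i => simp [uGen_mul_self]

/-- For `i ≠ j` the order is `2` or `3`, so both braid words contain both letters and vanish if one
of these is the last generator. -/
lemma prod_map_extGen_braid {n : ℕ} (i j : Fin (n + 1)) :
    ((CoxeterSystem.alternatingWord i j (coxD (n + 1) i j)).map (extGen β n)).prod =
      ((CoxeterSystem.alternatingWord j i (coxD (n + 1) i j)).map (extGen β n)).prod := by
  have hzero : ∀ i j : Fin (n + 1), i ≠ j → (i = Fin.last n ∨ j = Fin.last n) →
      ((CoxeterSystem.alternatingWord i j (coxD (n + 1) i j)).map (extGen β n)).prod = 0 := by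
    intro i j hij h
    rcases coxD_simplyLaced (n + 1) i j hij with hm | hm <;> rcases h with rfl | rfl <;>
      simp [hm, CoxeterSystem.alternatingWord]
  by_cases hij : i = j
  · rw [hij]
  by_cases h : i = Fin.last n ∨ j = Fin.last n
  · rw [hzero i j hij h, (coxD (n + 1)).symmetric i j, hzero j i (Ne.symm hij) h.symm]
  · rw [not_or] at h
    obtain ⟨i, rfl⟩ := Fin.exists_castSucc_eq.2 h.1
    obtain ⟨j, rfl⟩ := Fin.exists_castSucc_eq.2 h.2
    have hcast : ∀ (m : ℕ) (i j : Fin n),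
        (CoxeterSystem.alternatingWord i.castSucc j.castSucc m).map (extGen β n) =
          (CoxeterSystem.alternatingWord i j m).map (uGen (coxD n) β) := by
      intro m
      induction m with
      | zero => intros; rfl
      | succ m ih => intro i j; simp [CoxeterSystem.alternatingWord, ih]
    rw [hcast, hcast, coxD_castSucc]
    exact prod_map_uGen_braid i j

variable (β) in
/-- The homomorphism that kills the last generator. -/
def restrict (n : ℕ) : IdCox (coxD (n + 1)) β →ₐ[R] IdCox (coxD n) β :=
  IdCox.lift (extGen β n) extGen_mul_self prod_map_extGen_braid

@[simp] lemma restrict_uGen {n : ℕ} (i : Fin (n + 1)) :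
    restrict β n (uGen (coxD (n + 1)) β i) = extGen β n i :=
  IdCox.lift_uGen _ _ _ i

lemma restrict_prod_map_castSucc {n : ℕ} (ω : List (Fin n)) :
    restrict β n (((ω.map Fin.castSucc).map (uGen (coxD (n + 1)) β)).prod) =
      (ω.map (uGen (coxD n) β)).prod := by
  rw [map_list_prod, map_map, map_map]
  congr 1
  apply map_congr_left
  intro i _
  simp

lemma incl_word {n : ℕ} (ω : List (Fin n)) :
    incl n (word (coxD n) ω) = word (coxD (n + 1)) (ω.map Fin.castSucc) := by
  rw [word, word, CoxeterSystem.wordProd, CoxeterSystem.wordProd, map_list_prod, map_map, map_map]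
  congr 1

/-- At `β = 0` the product of a non-reduced image would vanish, but `restrict` sends it to a nonzero
`u_w`. -/
lemma isReduced_map_castSucc {n : ℕ} {ω : List (Fin n)}
    (h : (coxD n).toCoxeterSystem.IsReduced ω) :
    (coxD (n + 1)).toCoxeterSystem.IsReduced (ω.map Fin.castSucc) := by
  by_contra hn
  have h₁ := prod_map_uGen_zero_of_not_isReduced (R := ℤ) (coxD_simplyLaced (n + 1)) hn
  have h₂ := congrArg (restrict (0 : ℤ) n) h₁
  rw [restrict_prod_map_castSucc, map_zero,
    prod_map_uGen_of_isReduced (coxD_simplyLaced n) h] at h₂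
  exact uElt_ne_zero (coxD_simplyLaced n) _ h₂

lemma restrict_uElt_incl {n : ℕ} (w : WD n) :
    restrict β n (uElt (coxD (n + 1)) β (incl n w)) = uElt (coxD n) β w := by
  obtain ⟨ω, hω, rfl, e⟩ := uElt_eq_prod (β := β) w
  rw [incl_word, ← prod_map_uGen_of_isReduced (coxD_simplyLaced _) (isReduced_map_castSucc hω),
    restrict_prod_map_castSucc, e]

lemma incl_injective (n : ℕ) : Function.Injective (incl n) := by
  intro w w' h
  apply uElt_injective (β := (0 : ℤ)) (coxD_simplyLaced n)
  rw [← restrict_uElt_incl, h, restrict_uElt_incl]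

/-- Any word for such a `v` uses the last generator, which is sent to `0`. -/
lemma restrict_uElt_of_notMem_range {n : ℕ} {v : WD (n + 1)} (hv : v ∉ Set.range (incl n)) :
    restrict β n (uElt (coxD (n + 1)) β v) = 0 := by
  obtain ⟨ω, hω, rfl, e⟩ := uElt_eq_prod (β := β) v
  rw [e, map_list_prod, map_map]
  by_cases hl : Fin.last n ∈ ω
  · apply prod_eq_zero
    exact mem_map.2 ⟨_, hl, by simp⟩
  · exfalso
    apply hv
    obtain ⟨ω', rfl⟩ : ∃ ω' : List (Fin n), ω'.map Fin.castSucc = ω := by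
      clear e hω hv
      induction ω with
      | nil => exact ⟨[], rfl⟩
      | cons i ω ih =>
        rw [mem_cons, not_or] at hl
        obtain ⟨ω', rfl⟩ := ih hl.2
        obtain ⟨i, rfl⟩ := Fin.exists_castSucc_eq.2 (Ne.symm hl.1)
        exact ⟨i :: ω', rfl⟩
    exact ⟨word (coxD n) ω', incl_word ω'⟩

lemma restrict_sum {n : ℕ} (g : WD (n + 1) →₀ R) :
    restrict β n (g.sum fun v c => c • uElt (coxD (n + 1)) β v) =
      (g.comapDomain (incl n) (incl_injective n).injOn).sum fun w c => c • uElt (coxD n) β w := by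
  rw [map_finsuppSum, Finsupp.sum, Finsupp.sum, Finsupp.comapDomain_support]
  simp only [map_smul, Finsupp.comapDomain_apply]
  rw [← Finset.sum_preimage (incl n) g.support (incl_injective n).injOn
    (fun v => g v • restrict β n (uElt (coxD (n + 1)) β v))]
  · apply Finset.sum_congr rfl
    intro w _
    rw [restrict_uElt_incl]
  · intro v _ hv
    rw [restrict_uElt_of_notMem_range hv, smul_zero]

lemma restrict_h_castSucc {n : ℕ} (y : R) (i : Fin n) :
    restrict β n (h (coxD (n + 1)) β y i.castSucc) = h (coxD n) β y i := by
  simp [h]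

lemma restrict_h_last (n : ℕ) (y : R) :
    restrict β n (h (coxD (n + 1)) β y (Fin.last n)) = 1 := by
  simp [h]

lemma restrict_hProd_map_castSucc {n : ℕ} (y : R) (ω : List (Fin n)) :
    restrict β n (hProd (coxD (n + 1)) β y (ω.map Fin.castSucc)) = hProd (coxD n) β y ω := by
  rw [hProd, hProd, map_list_prod, map_map, map_map]
  congr 1
  apply map_congr_left
  intro i _
  simp [restrict_h_castSucc]

lemma drop_finRange_succ {n i : ℕ} (hi : i ≤ n) :
    (finRange (n + 1)).drop i = ((finRange n).drop i).map Fin.castSucc ++ [Fin.last n] := by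
  rw [finRange_succ_last, drop_append_of_le_length (by simpa using hi), map_drop]

lemma restrict_hProd_drop {n i : ℕ} (hi : i ≤ n) (y : R) :
    restrict β n (hProd (coxD (n + 1)) β y ((finRange (n + 1)).drop i)) =
      hProd (coxD n) β y ((finRange n).drop i) := by
  rw [drop_finRange_succ hi, hProd, map_append, prod_append, map_mul, ← hProd,
    restrict_hProd_map_castSucc, map_singleton, prod_singleton, restrict_h_last, mul_one]

lemma restrict_hProd_drop_reverse {n i : ℕ} (hi : i ≤ n) (y : R) :
    restrict β n (hProd (coxD (n + 1)) β y ((finRange (n + 1)).drop i).reverse) =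
      hProd (coxD n) β y ((finRange n).drop i).reverse := by
  rw [drop_finRange_succ hi, reverse_append, ← map_reverse, reverse_singleton, hProd, map_append,
    prod_append, map_mul, ← hProd, ← hProd, restrict_hProd_map_castSucc, hProd, map_singleton,
    prod_singleton, restrict_h_last, one_mul]

lemma restrict_FD {n : ℕ} (hn : 2 ≤ n) (y : R) :
    restrict β n (FD (n + 1) β y) = FD n β y := by
  have ht : (finRange (n + 1)).take 2 = ((finRange n).take 2).map Fin.castSucc := by
    rw [finRange_succ_last, take_append_of_le_length (by simpa using hn), map_take]
  rw [FD, FD, map_mul, map_mul, restrict_hProd_drop hn, restrict_hProd_drop_reverse hn, ht,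
    restrict_hProd_map_castSucc]

lemma restrict_GA {n : ℕ} (hn : 1 ≤ n) (y : ℕ → R) :
    restrict β n (GA (n + 1) β y) = GA n β y := by
  obtain ⟨m, rfl⟩ := Nat.exists_eq_add_of_le' hn
  rw [GA, GA, map_list_prod, map_map, Nat.add_sub_cancel, Nat.add_sub_cancel, range_succ,
    map_append, prod_append, map_singleton, prod_singleton, Function.comp_apply, A,
    restrict_hProd_drop_reverse le_rfl, drop_of_length_le (by simp)]
  rw [show hProd (coxD (m + 1)) β (y (m + 1)) [].reverse = 1 from rfl, mul_one]
  congr 1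
  apply map_congr_left
  intro i hi
  rw [mem_range] at hi
  exact restrict_hProd_drop_reverse (by omega) _

lemma FD_zero (n : ℕ) : FD n β 0 = 1 := by
  have : ∀ l, hProd (coxD n) β 0 l = 1 := fun l => fwd_zero (u := uGen (coxD n) β) l
  rw [FD, this, this, this, one_mul, one_mul]

lemma isUnit_GA {n : ℕ} {b : ℕ → R} (hb : ∀ j, IsUnit (1 + β * b j)) :
    IsUnit (GA n β fun i => ominus β (b i)) := by
  rw [GA_eq_stair]
  exact ⟨⟨_, _, stair_mul_invStair uGen_mul_self _ (fun k => hb (k + 1)),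
    invStair_mul_stair uGen_mul_self _ (fun k => hb (k + 1))⟩, rfl⟩

/-- Factors at the last generator become `1`, so the extra column `A_n` of each `G_A` disappears.
The extra `F(x_{n+1})` is `F(0) = 1`. -/
lemma restrict_genD {a b x : ℕ → R} (hb : ∀ j, IsUnit (1 + β * b j)) {n : ℕ} (hn : 2 ≤ n) :
    restrict β n (genD (n + 1) β a b (Function.update x (n + 1) 0)) = genD n β a b x := by
  have hinv : restrict β n (Ring.inverse (GA (n + 1) β fun i => ominus β (b i))) =
      Ring.inverse (GA n β fun i => ominus β (b i)) := by
    obtain ⟨g, hg⟩ := isUnit_GA (n := n + 1) hb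
    rw [← restrict_GA (n := n) (by omega), ← hg, Ring.inverse_unit]
    exact (Ring.inverse_unit (Units.map (MonoidHomClass.toMonoidHom (restrict β n)) g)).symm
  rw [genD, genD, map_mul, map_mul, hinv, restrict_GA (by omega), range_succ, map_append,
    prod_append, map_singleton, prod_singleton, Function.update_self, FD_zero, mul_one,
    map_list_prod, map_map]
  congr 3
  apply map_congr_left
  intro i hi
  rw [mem_range] at hi
  rw [Function.comp_apply, Function.update_of_ne (by omega), restrict_FD hn]

end Restriction

end GrothD

lemma GrothD.isGrothD_of_eq_sum {R : Type*} [CommRing R] {β : R} {n : ℕ} {a b x : ℕ → R}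
    {g : GrothD.WD n →₀ R} (hg : GrothD.genD n β a b x =
      g.sum fun w c => c • GrothD.uElt (GrothD.coxD n) β w) :
    GrothD.IsGrothD n β a b x g := by
  intro g'
  constructor
  · intro h
    exact GrothD.sum_smul_uElt_injective (GrothD.coxD_simplyLaced n) (h.symm.trans hg)
  · rintro rfl
    exact hg

end

theorem theorem6 {R : Type*} [CommRing R] (β : R) (a b x : ℕ → R)
    (hb : ∀ j, IsUnit (1 + β * b j)) (n : ℕ) (hn : 2 ≤ n) :
    ∃ g : GrothD.WD n →₀ R, GrothD.IsGrothD n β a b x g ∧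
      (Even n → ∀ w : GrothD.WD n, g w = GrothD.eydSum n β a b x w) ∧
      (Odd n → ∀ w : GrothD.WD n,
        g w = GrothD.eydSum (n + 1) β a b (Function.update x (n + 1) 0) (GrothD.incl n w)) := by
  rcases Nat.even_or_odd n with he | ho
  · refine ⟨GrothD.subwordSum (GrothD.coxD n) β (GrothD.wtD n β a b x) (GrothD.deltaD n),
      GrothD.isGrothD_of_eq_sum ?_, fun _ w => GrothD.subwordSum_apply _ _ _ _ w,
      fun ho => absurd he (Nat.not_even_iff_odd.2 ho)⟩
    rw [GrothD.genD_eq_prod hb hn he, GrothD.prod_map_h_eq_sum _ _ _ (GrothD.coxD_simplyLaced n)]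
  · refine ⟨(GrothD.subwordSum (GrothD.coxD (n + 1)) β
        (GrothD.wtD (n + 1) β a b (Function.update x (n + 1) 0))
        (GrothD.deltaD (n + 1))).comapDomain (GrothD.incl n) (GrothD.incl_injective n).injOn,
      GrothD.isGrothD_of_eq_sum ?_, fun he => absurd he (Nat.not_even_iff_odd.2 ho),
      fun _ w => GrothD.subwordSum_apply _ _ _ _ _⟩
    -- The expansion for the even rank `n + 1` is restricted to rank `n`; only the coefficients at
    -- elements of `W(D_n)` survive.
    rw [← GrothD.restrict_sum, ← GrothD.prod_map_h_eq_sum _ _ _ (GrothD.coxD_simplyLaced (n + 1)),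
      ← GrothD.genD_eq_prod hb (by omega) ho.add_one, GrothD.restrict_genD hb hn]
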